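/- For a finite simple graph $H$ and $n\in\mathbb N$, an edge colouring of $K_n$ admits an even-chromatic copy of $H$ if there is an injection $f\colon V(H)\to V(K_n)$ such that every colour occurs on an even number of edges of $f(H)$. Let $r_H(n)$ be the least number of colours of an edge colouring of $K_n$ that does not admit an even-chromatic copy of $H$, with $r_H(n)=\infty$ if there is no such colouring. Let $\mathbb F_2^{K_n}$ be the $\mathbb F_2$-vector space of all graphs with vertex set $[n]$, where the sum of two graphs has as its edge set the symmetric difference of their edge sets. A graph $G$ on $[n]$ is a copy of $H$ if there is $S\subseteq[n]$ such that $G[S]$ is isomorphic to $H$ and all vertices in $[n]\setminus S$ are isolated in $G$. Put $$d^{\mathrm{lin}}_H(n)=2^{-\binom n2}\max\{|\mathcal C| : \mathcal C\subseteq\mathbb F_2^{K_n}\text{ is a subspace that contains no copy of }H\},$$ where the maximum is $0$ if there is no such subspace. There is an absolute constant $c>0$ such that for every finite graph $H$ with an even number of edges there is $n_0=n_0(H)$ such that, for all $n\ge n_0$, $$r_H(n)\ge c\log n\qquad\text{and}\qquad d^{\mathrm{lin}}_H(n)\le (c\log n)^{-1},$$ where $\log$ is the natural logarithm. -/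

import Mathlib

open Filter
open scoped ENNReal

namespace GraphCode

variable {V : Type*}

/-- The edge colouring `χ` of `K_n` admits an even-chromatic copy of `H`: there is an injection `f`
of the vertices of `H` into those of `K_n` such that every colour is found on an even number of
edges of the image graph `f(H)`. -/
def AdmitsEvenChromaticCopy {n : ℕ} {K : Type*} (χ : (⊤ : SimpleGraph (Fin n)).edgeSet → K)
    (H : SimpleGraph V) : Prop :=
  ∃ f : V ↪ Fin n, ∀ k : K,
    Even {e : (⊤ : SimpleGraph (Fin n)).edgeSet | e.1 ∈ (H.map f).edgeSet ∧ χ e = k}.ncard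

/-- `r_H(n)`: the least number of colours of an edge colouring of `K_n` that does not admit an
even-chromatic copy of `H`. It is `⊤` if there is no such colouring. -/
noncomputable def colorNumber (H : SimpleGraph V) (n : ℕ) : ℕ∞ :=
  sInf {N : ℕ∞ | ∃ r : ℕ, N = r ∧
    ∃ χ : (⊤ : SimpleGraph (Fin n)).edgeSet → Fin r, ¬ AdmitsEvenChromaticCopy χ H}

/-- The vector space `𝔽₂^{K_n}` of graphs with vertex set `Fin n`, each graph being given by the
indicator function of its edge set; addition is the symmetric difference of edge sets. -/
abbrev EdgeSpace (n : ℕ) : Type := (⊤ : SimpleGraph (Fin n)).edgeSet → ZMod 2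

/-- The graph with indicator function `x`. -/
def EdgeSpace.graph {n : ℕ} (x : EdgeSpace n) : SimpleGraph (Fin n) :=
  SimpleGraph.fromEdgeSet {e | ∃ h : e ∈ (⊤ : SimpleGraph (Fin n)).edgeSet, x ⟨e, h⟩ = 1}

/-- `G` is a copy of `H`: some set `S` of vertices induces in `G` a graph isomorphic to `H`, and all
vertices outside `S` are isolated in `G`. -/
def IsCopyOf {n : ℕ} (G : SimpleGraph (Fin n)) (H : SimpleGraph V) : Prop :=
  ∃ S : Set (Fin n), Nonempty (G.induce S ≃g H) ∧ ∀ v, v ∉ S → G.IsIsolated v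

/-- `d^lin_H(n)`: the maximal size of a subspace of `𝔽₂^{K_n}` that contains no copy of `H`, divided
by `2 ^ (n choose 2)`. The maximum is over a finite set of numbers, and it is `0` if there is no
such subspace (which is the case if `H` has no edges and at most `n` vertices). -/
noncomputable def linDensity (H : SimpleGraph V) (n : ℕ) : ℝ :=
  (sSup {N : ℕ | ∃ C : Submodule (ZMod 2) (EdgeSpace n),
    (∀ x ∈ C, ¬ IsCopyOf x.graph H) ∧ N = Nat.card C} : ℕ) / (2 : ℝ) ^ n.choose 2

end GraphCode

/-! Both bounds follow from one fact: if `n` is large and the number of colours is below a small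
constant times `log n`, there is an even-chromatic copy of `H`. For the linear bound, a subspace `C`
without copies of `H` colours each edge by the class of its basis vector modulo `C`. The edges of an
even-chromatic copy would sum to zero in the quotient and so put a copy into `C`
(`not_admits_of_submodule`); hence the index of `C` is bounded below like a number of colours.

To find copies, `H` is split into pieces with an even number of edges between them. Dependent random
choice yields a colour and a set of `N ^ (1 - ε)` vertices in which all tuples of a given length
have `N ^ (1 - ε)` common neighbours in that colour. One piece is embedded in this set, the next one
in the common neighbourhood of its image, and all edges between them get the same colour
(`Unavoidable.union`). As `ε` is arbitrary, the constant does not deteriorate with the size of `H`.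
A vertex of even degree or a non-adjacent pair of vertices of odd degree can be split off; otherwise
the graph is complete of even order, and a `K₄` can be split off (`unavoidable_of_even`). So only
`K₄` needs a separate argument.

For `K₄`, let `p` be the density of monochromatic cherries in a set `D`, let `κ` be its number of
colours, and choose `A` to maximise `p ^ 2 * |D| / (2 ^ 520) ^ κ`. Relate `x` to `y` if `xy` has the
most popular colour at `x`; this relation has density at least `p` on `A`. If there is no twisted
`K₄`, then two sets that are completely related share no colours. A set with few colours has small
cherry density by the choice of `A`, so it is rich in rainbow tuples; dependent random choice gives
one with many common neighbours. These common neighbours avoid all colours of the tuple, so they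
form a set that is even poorer in colours for its size. Iterating with the two sides swapped
(`DensePair.exists_next`) pushes the cherry density below the trivial lower bound, the inverse of
the number of colours. -/

namespace GraphCode

/-! ### Monochromatic cherries and rainbow tuples -/

section Rainbow

set_option linter.unusedSectionVars false

variable {α L : Type*} [DecidableEq α] [DecidableEq L] [Fintype L]

/-- The neighbourhood of `b` in `D` in colour `g`. -/
def colorNbhd (c : α → α → L) (D : Finset α) (b : α) (g : L) : Finset α :=
  D.filter fun u => c b u = g

/-- The number of triples `(b, u, v)` in `D` with `c b u = c b v`. -/
def cherries (c : α → α → L) (D : Finset α) : ℕ :=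
  ∑ b ∈ D, ∑ g, (colorNbhd c D b g).card ^ 2

/-- The proportion of triples `(b, u, v)` in `D` with `c b u = c b v`. -/
noncomputable def cherryDensity (c : α → α → L) (D : Finset α) : ℝ :=
  (cherries c D : ℝ) / (D.card : ℝ) ^ 3

/-- The set of colours on pairs of distinct elements of `D`. -/
def colorsOn (c : α → α → L) (D : Finset α) : Finset L :=
  D.offDiag.image fun x => c x.1 x.2

theorem sum_card_colorNbhd (c : α → α → L) (D : Finset α) (b : α) :
    ∑ g, (colorNbhd c D b g).card = D.card :=
  (Finset.card_eq_sum_card_fiberwise (f := c b) (t := Finset.univ) (by simp)).symm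

theorem card_sq_le_cherries (c : α → α → L) (D : Finset α) :
    D.card ^ 2 ≤ cherries c D := by
  calc D.card ^ 2 = ∑ b ∈ D, ∑ g, (colorNbhd c D b g).card := by
        simp [sum_card_colorNbhd, sq]
    _ ≤ cherries c D := by
        unfold cherries
        gcongr with b _ g _
        exact Nat.le_self_pow (by norm_num) _

theorem cherries_le (c : α → α → L) (D : Finset α) : cherries c D ≤ D.card ^ 3 := by
  calc cherries c D ≤ ∑ b ∈ D, ∑ g, (colorNbhd c D b g).card * D.card := by
        unfold cherries
        gcongr with b _ g _
        rw [sq]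
        exact Nat.mul_le_mul_left _ (Finset.card_filter_le _ _)
    _ = D.card ^ 3 := by
        simp_rw [← Finset.sum_mul, sum_card_colorNbhd]
        simp; ring

/-- Cauchy–Schwarz over the colours at each vertex. This is the lower bound on the cherry density
that the iteration finally contradicts. -/
theorem card_pow_three_le_cherries (c : α → α → L) (D : Finset α) :
    D.card ^ 3 ≤ Fintype.card L * cherries c D := by
  calc D.card ^ 3 = ∑ b ∈ D, (∑ g, (colorNbhd c D b g).card) ^ 2 := by
        simp [sum_card_colorNbhd]; ring
    _ ≤ ∑ b ∈ D, Fintype.card L * ∑ g, (colorNbhd c D b g).card ^ 2 := by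
        gcongr with b _
        simpa using sq_sum_le_card_mul_sum_sq (s := Finset.univ)
          (f := fun g => (colorNbhd c D b g).card)
    _ = Fintype.card L * cherries c D := by
        rw [← Finset.mul_sum]; rfl

theorem cherryDensity_nonneg (c : α → α → L) (D : Finset α) : 0 ≤ cherryDensity c D := by
  unfold cherryDensity; positivity

theorem cherryDensity_le_one (c : α → α → L) (D : Finset α) : cherryDensity c D ≤ 1 := by
  unfold cherryDensity
  refine div_le_one_of_le₀ ?_ (by positivity)
  exact_mod_cast cherries_le c D

theorem one_le_card_mul_cherryDensity (c : α → α → L) {D : Finset α} (hD : D.Nonempty) :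
    1 ≤ (Fintype.card L : ℝ) * cherryDensity c D := by
  have h : 0 < (D.card : ℝ) := by exact_mod_cast hD.card_pos
  unfold cherryDensity
  rw [← mul_div_assoc, le_div_iff₀ (by positivity), one_mul]
  exact_mod_cast card_pow_three_le_cherries c D

theorem cherries_eq_mul (c : α → α → L) (D : Finset α) :
    (cherries c D : ℝ) = cherryDensity c D * (D.card : ℝ) ^ 3 := by
  rcases D.eq_empty_or_nonempty with rfl | hD
  · simp [cherries]
  · have h : 0 < (D.card : ℝ) := by exact_mod_cast hD.card_pos
    unfold cherryDensity
    field_simp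

/-- Tuples from `D` whose restriction along an injection is prescribed. -/
theorem card_tuples_le {ι κ : Type*} [Fintype ι] [Fintype κ] [DecidableEq ι] [DecidableEq κ]
    (e : κ ↪ ι) (D : Finset α) (P : (κ → α) → Prop) [DecidablePred P] :
    ((Fintype.piFinset fun _ : ι => D).filter fun T => P (T ∘ e)).card ≤
      ((Fintype.piFinset fun _ : κ => D).filter P).card *
        D.card ^ (Fintype.card ι - Fintype.card κ) := by
  have hc : Fintype.card {x : ι // x ∉ Set.range e} = Fintype.card ι - Fintype.card κ := by
    rw [Fintype.card_subtype_compl]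
    congr 1
    exact (Fintype.card_congr (Equiv.ofInjective e e.injective)).symm
  have : ((Fintype.piFinset fun _ : κ => D).filter P).card *
        D.card ^ (Fintype.card ι - Fintype.card κ) =
      (((Fintype.piFinset fun _ : κ => D).filter P) ×ˢ
        (Fintype.piFinset fun _ : {x : ι // x ∉ Set.range e} => D)).card := by
    rw [Finset.card_product, Fintype.card_piFinset (fun _ : {x : ι // x ∉ Set.range e} => D),
      Finset.prod_const, Finset.card_univ, hc]
  rw [this]
  apply Finset.card_le_card_of_injOn (fun T => (T ∘ e, fun x => T x.1))
  · intro T hT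
    simp only [Finset.coe_filter, Fintype.mem_piFinset, Set.mem_ofPred_eq] at hT
    simp only [Finset.coe_product, Set.mem_prod, Finset.mem_coe, Finset.mem_filter,
      Fintype.mem_piFinset]
    exact ⟨⟨fun i => hT.1 _, hT.2⟩, fun i => hT.1 _⟩
  · intro T _ T' _ h
    simp only [Prod.mk.injEq] at h
    funext i
    by_cases hi : i ∈ Set.range e
    · obtain ⟨j, rfl⟩ := hi
      exact congrFun h.1 j
    · exact congrFun h.2 ⟨i, hi⟩

/-- A tuple of distinct elements, all of whose pairs have different colours. -/
def Rainbow (c : α → α → L) {m : ℕ} (T : Fin m → α) : Prop :=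
  Function.Injective T ∧ ∀ i j i' j', i < j → i' < j' → c (T i) (T j) = c (T i') (T j') →
    i = i' ∧ j = j'

theorem card_eq_pairs_le (c : α → α → L) (D : Finset α) :
    (((Fintype.piFinset fun _ : Fin 2 => D).filter fun T => T 0 = T 1).card : ℝ) ≤
      cherryDensity c D * (D.card : ℝ) ^ 2 := by
  rcases D.eq_empty_or_nonempty with rfl | hD
  · simp
  have h : 0 < (D.card : ℝ) := by exact_mod_cast hD.card_pos
  have h1 : ((Fintype.piFinset fun _ : Fin 2 => D).filter fun T => T 0 = T 1).card ≤ D.card := by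
    apply Finset.card_le_card_of_injOn (fun T => T 0)
    · intro T hT
      simp only [Finset.coe_filter, Fintype.mem_piFinset, Set.mem_ofPred_eq] at hT
      exact hT.1 0
    · intro T hT T' hT' h
      simp only [Finset.coe_filter, Fintype.mem_piFinset, Set.mem_ofPred_eq] at hT hT'
      simp only at h
      funext i
      fin_cases i
      · exact h
      · simp [← hT.2, ← hT'.2, h]
  have h2 : ((D.card : ℝ)) ^ 2 ≤ cherryDensity c D * (D.card : ℝ) ^ 3 := by
    rw [← cherries_eq_mul]; exact_mod_cast card_sq_le_cherries c D
  have h3 : (D.card : ℝ) ≤ cherryDensity c D * (D.card : ℝ) ^ 2 := by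
    have : (D.card : ℝ) * D.card ≤ cherryDensity c D * (D.card : ℝ) ^ 2 * D.card := by
      linarith
    exact le_of_mul_le_mul_right this h
  calc _ ≤ (D.card : ℝ) := by exact_mod_cast h1
    _ ≤ _ := h3

theorem card_mono_cherry_le (c : α → α → L) (D : Finset α) :
    (((Fintype.piFinset fun _ : Fin 3 => D).filter fun T => c (T 0) (T 1) = c (T 0) (T 2)).card : ℝ)
      ≤ cherryDensity c D * (D.card : ℝ) ^ 3 := by
  rw [← cherries_eq_mul]
  have h : ((Fintype.piFinset fun _ : Fin 3 => D).filter
      fun T => c (T 0) (T 1) = c (T 0) (T 2)).card ≤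
      (D.sigma fun b => (Finset.univ : Finset L).sigma fun g =>
        colorNbhd c D b g ×ˢ colorNbhd c D b g).card := by
    apply Finset.card_le_card_of_injOn (fun T => ⟨T 0, c (T 0) (T 1), T 1, T 2⟩)
    · intro T hT
      simp only [Finset.coe_filter, Fintype.mem_piFinset, Set.mem_ofPred_eq] at hT
      simp [colorNbhd, hT.1, hT.2]
    · intro T hT T' hT' h
      simp only [Sigma.mk.injEq] at h
      obtain ⟨h0, h1⟩ := h
      have h2 := (Sigma.mk.inj (eq_of_heq h1)).2
      have h3 := Prod.mk.inj (eq_of_heq h2)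
      funext i
      fin_cases i
      · exact h0
      · exact h3.1
      · exact h3.2
  have h' : (D.sigma fun b => (Finset.univ : Finset L).sigma fun g =>
        colorNbhd c D b g ×ˢ colorNbhd c D b g).card = cherries c D := by
    simp [Finset.card_sigma, cherries, sq]
  exact_mod_cast h.trans h'.le

/-- A colour `g` accounts for the square of the sum over `b` of the degrees of `b` in `g`;
Cauchy–Schwarz over `b` bounds it by `|D|` times the cherries in `g`. -/
theorem card_eq_edges_le (c : α → α → L) (D : Finset α) :
    (((Fintype.piFinset fun _ : Fin 4 => D).filter fun T => c (T 0) (T 1) = c (T 2) (T 3)).card : ℝ)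
      ≤ cherryDensity c D * (D.card : ℝ) ^ 4 := by
  have h : ((Fintype.piFinset fun _ : Fin 4 => D).filter
      fun T => c (T 0) (T 1) = c (T 2) (T 3)).card ≤
      ((Finset.univ : Finset L).sigma fun g =>
        (D.sigma fun b => colorNbhd c D b g) ×ˢ (D.sigma fun b => colorNbhd c D b g)).card := by
    apply Finset.card_le_card_of_injOn
      (fun T => ⟨c (T 0) (T 1), ⟨T 0, T 1⟩, ⟨T 2, T 3⟩⟩)
    · intro T hT
      simp only [Finset.coe_filter, Fintype.mem_piFinset, Set.mem_ofPred_eq] at hT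
      simp [colorNbhd, hT.1, hT.2]
    · intro T hT T' hT' h
      simp only [Sigma.mk.injEq] at h
      have h2 := Prod.mk.inj (eq_of_heq h.2)
      have h3 := Sigma.mk.inj h2.1
      have h4 := Sigma.mk.inj h2.2
      funext i
      fin_cases i
      · exact h3.1
      · exact eq_of_heq h3.2
      · exact h4.1
      · exact eq_of_heq h4.2
  have h' : ((Finset.univ : Finset L).sigma fun g =>
        (D.sigma fun b => colorNbhd c D b g) ×ˢ (D.sigma fun b => colorNbhd c D b g)).card
      ≤ D.card * cherries c D := by
    rw [Finset.card_sigma]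
    calc _ = ∑ g, (∑ b ∈ D, (colorNbhd c D b g).card) ^ 2 := by
          simp [Finset.card_sigma, sq]
      _ ≤ ∑ g, D.card * ∑ b ∈ D, (colorNbhd c D b g).card ^ 2 := by
          gcongr with g _
          exact sq_sum_le_card_mul_sum_sq
      _ = D.card * cherries c D := by
          rw [← Finset.mul_sum, Finset.sum_comm]; rfl
  have h2 := h.trans h'
  have h3 : cherryDensity c D * (D.card : ℝ) ^ 4 = D.card * cherries c D := by
    rw [cherries_eq_mul]; ring
  rw [h3]
  exact_mod_cast h2

theorem pair_embedding_exists {m : ℕ} {i j : Fin m} (h : i ≠ j) :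
    ∃ e : Fin 2 ↪ Fin m, e 0 = i ∧ e 1 = j :=
  ⟨⟨![i, j], by intro a b; fin_cases a <;> fin_cases b <;> simp [h, h.symm]⟩, rfl, rfl⟩

theorem triple_embedding_exists {m : ℕ} {i j k : Fin m} (h : i ≠ j) (h2 : i ≠ k) (h3 : j ≠ k) :
    ∃ e : Fin 3 ↪ Fin m, e 0 = i ∧ e 1 = j ∧ e 2 = k :=
  ⟨⟨![i, j, k], by
    intro a b; fin_cases a <;> fin_cases b <;> simp [h, h.symm, h2, h2.symm, h3, h3.symm]⟩,
    rfl, rfl, rfl⟩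

theorem quadruple_embedding_exists {m : ℕ} {i j k l : Fin m} (h : i ≠ j) (h2 : i ≠ k)
    (h3 : i ≠ l) (h4 : j ≠ k) (h5 : j ≠ l) (h6 : k ≠ l) :
    ∃ e : Fin 4 ↪ Fin m, e 0 = i ∧ e 1 = j ∧ e 2 = k ∧ e 3 = l :=
  ⟨⟨![i, j, k, l], by
    intro a b; fin_cases a <;> fin_cases b <;>
      simp [h, h.symm, h2, h2.symm, h3, h3.symm, h4, h4.symm, h5, h5.symm, h6, h6.symm]⟩,
    rfl, rfl, rfl, rfl⟩

/-- Two pairs of indices with equal colours either share an index, which gives a cherry, or are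
disjoint. Each obstruction lives on at most four indices and has density at most the cherry density.
-/
theorem not_rainbow_cases {c : α → α → L} (hc : ∀ x y, c x y = c y x) {m : ℕ} {T : Fin m → α}
    (h : ¬ Rainbow c T) :
    (∃ e : Fin 2 ↪ Fin m, (T ∘ e) 0 = (T ∘ e) 1) ∨
    (∃ e : Fin 3 ↪ Fin m, c ((T ∘ e) 0) ((T ∘ e) 1) = c ((T ∘ e) 0) ((T ∘ e) 2)) ∨
    (∃ e : Fin 4 ↪ Fin m, c ((T ∘ e) 0) ((T ∘ e) 1) = c ((T ∘ e) 2) ((T ∘ e) 3)) := by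
  unfold Rainbow at h
  rw [not_and_or] at h
  rcases h with h | h
  · simp only [Function.Injective] at h
    push Not at h
    obtain ⟨i, j, hT, hij⟩ := h
    obtain ⟨e, rfl, rfl⟩ := pair_embedding_exists hij
    exact .inl ⟨e, hT⟩
  right
  push Not at h
  obtain ⟨i, j, k, l, hij, hkl, hT, hne⟩ := h
  have key : ∀ x y z : Fin m, x ≠ y → x ≠ z → y ≠ z → c (T x) (T y) = c (T x) (T z) →
      ∃ e : Fin 3 ↪ Fin m, c ((T ∘ e) 0) ((T ∘ e) 1) = c ((T ∘ e) 0) ((T ∘ e) 2) := by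
    intro x y z h1 h2 h3 h4
    obtain ⟨e, rfl, rfl, rfl⟩ := triple_embedding_exists h1 h2 h3
    exact ⟨e, h4⟩
  by_cases h1 : i = k
  · subst h1
    exact .inl (key i j l hij.ne hkl.ne (hne rfl) hT)
  by_cases h2 : i = l
  · subst h2
    exact .inl (key i j k hij.ne hkl.ne' (hkl.trans hij).ne' (hT.trans (hc _ _)))
  by_cases h3 : j = k
  · subst h3
    exact .inl (key j i l hij.ne' hkl.ne (hij.trans hkl).ne ((hc _ _).trans hT))
  by_cases h4 : j = l
  · subst h4
    exact .inl (key j i k hij.ne' hkl.ne' h1 ((hc _ _).trans (hT.trans (hc _ _))))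
  obtain ⟨e, rfl, rfl, rfl, rfl⟩ := quadruple_embedding_exists hij.ne h1 h2 h3 h4 hkl.ne
  exact .inr ⟨e, hT⟩

open Classical in
-- Union bound over the positions of the obstruction, of which there are at most `m ^ r ≤ m ^ 4`.
theorem card_tuples_exists_embedding_le (c : α → α → L) (m : ℕ) (D : Finset α) {r : ℕ}
    (P : (Fin r → α) → Prop) (hr1 : 1 ≤ r) (hr : r ≤ 4)
    (hP : (((Fintype.piFinset fun _ : Fin r => D).filter P).card : ℝ) ≤
      cherryDensity c D * (D.card : ℝ) ^ r)
    (F : Finset (Fin m → α)) (hF : ∀ T ∈ F, (∀ i, T i ∈ D) ∧ ∃ e : Fin r ↪ Fin m, P (T ∘ e)) :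
    (F.card : ℝ) ≤ (m : ℝ) ^ 4 * cherryDensity c D * (D.card : ℝ) ^ m := by
  have hsub : F ⊆
      ((Finset.univ : Finset (Fin r ↪ Fin m)).biUnion fun e =>
        (Fintype.piFinset fun _ : Fin m => D).filter fun T => P (T ∘ e)) := by
    intro T hT
    obtain ⟨h1, e, h2⟩ := hF T hT
    exact Finset.mem_biUnion.mpr ⟨e, Finset.mem_univ _,
      Finset.mem_filter.mpr ⟨Fintype.mem_piFinset.mpr h1, h2⟩⟩
  have hnn := cherryDensity_nonneg c D
  by_cases hrm : r ≤ m
  · have hcard : (Fintype.card (Fin r ↪ Fin m) : ℝ) ≤ (m : ℝ) ^ 4 := by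
      rw [Fintype.card_embedding_eq, Fintype.card_fin, Fintype.card_fin]
      have : m.descFactorial r ≤ m ^ 4 :=
        (Nat.descFactorial_le_pow _ _).trans (Nat.pow_le_pow_right (by omega) hr)
      exact_mod_cast this
    have h1 : ∀ e : Fin r ↪ Fin m,
        (((Fintype.piFinset fun _ : Fin m => D).filter fun T => P (T ∘ e)).card : ℝ) ≤
        cherryDensity c D * (D.card : ℝ) ^ m := by
      intro e
      have := card_tuples_le e D P
      rw [Fintype.card_fin, Fintype.card_fin] at this
      calc _ ≤ (((Fintype.piFinset fun _ : Fin r => D).filter P).card : ℝ) *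
              (D.card : ℝ) ^ (m - r) := by exact_mod_cast this
        _ ≤ cherryDensity c D * (D.card : ℝ) ^ r * (D.card : ℝ) ^ (m - r) := by gcongr
        _ = _ := by rw [mul_assoc, ← pow_add, Nat.add_sub_cancel' hrm]
    have h2 := (Finset.card_le_card hsub).trans Finset.card_biUnion_le
    calc _ ≤ ((∑ e : Fin r ↪ Fin m,
            ((Fintype.piFinset fun _ : Fin m => D).filter fun T => P (T ∘ e)).card : ℕ) : ℝ) :=
          Nat.cast_le.mpr h2
      _ ≤ ∑ e : Fin r ↪ Fin m, cherryDensity c D * (D.card : ℝ) ^ m := by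
          rw [Nat.cast_sum]
          exact Finset.sum_le_sum fun e _ => h1 e
      _ = (Fintype.card (Fin r ↪ Fin m) : ℝ) * (cherryDensity c D * (D.card : ℝ) ^ m) := by
          rw [Finset.sum_const, Finset.card_univ, nsmul_eq_mul]
      _ ≤ (m : ℝ) ^ 4 * (cherryDensity c D * (D.card : ℝ) ^ m) := by gcongr
      _ = _ := by ring
  · have hem : IsEmpty (Fin r ↪ Fin m) := by
      rw [← Fintype.card_eq_zero_iff, Fintype.card_embedding_eq, Fintype.card_fin,
        Fintype.card_fin, Nat.descFactorial_eq_zero_iff_lt]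
      omega
    have : F = ∅ := Finset.eq_empty_of_forall_notMem fun T hT => by
      obtain ⟨e, _⟩ := (hF T hT).2
      exact hem.elim e
    rw [this]
    simp only [Finset.card_empty, Nat.cast_zero]
    positivity

open Classical in
/-- At least half of the tuples in a set of small cherry density are rainbow. -/
theorem card_tuples_le_two_mul_rainbow {c : α → α → L} (hc : ∀ x y, c x y = c y x) {m : ℕ}
    {D : Finset α} (hD : 6 * (m : ℝ) ^ 4 * cherryDensity c D ≤ 1) :
    (D.card : ℝ) ^ m ≤
      2 * (((Fintype.piFinset fun _ : Fin m => D).filter (Rainbow c)).card : ℝ) := by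
  have hsplit := Finset.card_filter_add_card_filter_not
    (s := Fintype.piFinset fun _ : Fin m => D) (p := Rainbow c)
  rw [Fintype.card_piFinset] at hsplit
  simp only [Finset.prod_const, Finset.card_univ, Fintype.card_fin] at hsplit
  obtain ⟨F, hF⟩ : ∃ F, F = (Fintype.piFinset fun _ : Fin m => D).filter fun T => ¬ Rainbow c T :=
    ⟨_, rfl⟩
  have hFD : ∀ T ∈ F, ∀ i, T i ∈ D := fun T hT =>
    Fintype.mem_piFinset.mp (Finset.mem_filter.mp (hF ▸ hT)).1
  obtain ⟨P2, hP2⟩ : ∃ P : (Fin 2 → α) → Prop, P = fun T => T 0 = T 1 := ⟨_, rfl⟩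
  obtain ⟨P3, hP3⟩ : ∃ P : (Fin 3 → α) → Prop, P = fun T => c (T 0) (T 1) = c (T 0) (T 2) :=
    ⟨_, rfl⟩
  obtain ⟨P4, hP4⟩ : ∃ P : (Fin 4 → α) → Prop, P = fun T => c (T 0) (T 1) = c (T 2) (T 3) :=
    ⟨_, rfl⟩
  have b2 := card_tuples_exists_embedding_le c m D P2 (by norm_num) (by norm_num)
    (by convert card_eq_pairs_le c D; rw [hP2])
    (F.filter fun T => ∃ e : Fin 2 ↪ Fin m, P2 (T ∘ e))
    fun T hT => ⟨hFD T (Finset.mem_filter.mp hT).1, (Finset.mem_filter.mp hT).2⟩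
  have b3 := card_tuples_exists_embedding_le c m D P3 (by norm_num) (by norm_num)
    (by convert card_mono_cherry_le c D; rw [hP3])
    (F.filter fun T => ∃ e : Fin 3 ↪ Fin m, P3 (T ∘ e))
    fun T hT => ⟨hFD T (Finset.mem_filter.mp hT).1, (Finset.mem_filter.mp hT).2⟩
  have b4 := card_tuples_exists_embedding_le c m D P4 (by norm_num) (by norm_num)
    (by convert card_eq_edges_le c D; rw [hP4])
    (F.filter fun T => ∃ e : Fin 4 ↪ Fin m, P4 (T ∘ e))
    fun T hT => ⟨hFD T (Finset.mem_filter.mp hT).1, (Finset.mem_filter.mp hT).2⟩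
  have hbad : F ⊆ (F.filter fun T => ∃ e : Fin 2 ↪ Fin m, P2 (T ∘ e)) ∪
      ((F.filter fun T => ∃ e : Fin 3 ↪ Fin m, P3 (T ∘ e)) ∪
      (F.filter fun T => ∃ e : Fin 4 ↪ Fin m, P4 (T ∘ e))) := by
    intro T hT
    have hcase : (∃ e : Fin 2 ↪ Fin m, P2 (T ∘ e)) ∨ (∃ e : Fin 3 ↪ Fin m, P3 (T ∘ e)) ∨
        (∃ e : Fin 4 ↪ Fin m, P4 (T ∘ e)) := by
      rw [hP2, hP3, hP4]
      rw [hF, Finset.mem_filter] at hT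
      exact not_rainbow_cases hc hT.2
    rw [Finset.mem_union, Finset.mem_union, Finset.mem_filter, Finset.mem_filter,
      Finset.mem_filter]
    exact hcase.imp (fun h => ⟨hT, h⟩) (Or.imp (fun h => ⟨hT, h⟩) fun h => ⟨hT, h⟩)
  have hcard := (Finset.card_le_card hbad).trans ((Finset.card_union_le _ _).trans
    (Nat.add_le_add_left (Finset.card_union_le _ _) _))
  have hcard' : (F.card : ℝ) ≤ 3 * ((m : ℝ) ^ 4 * cherryDensity c D * (D.card : ℝ) ^ m) := by
    refine (Nat.cast_le.mpr hcard).trans ?_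
    rw [Nat.cast_add, Nat.cast_add]
    refine (add_le_add b2 (add_le_add b3 b4)).trans (le_of_eq (by ring))
  have hs : ((((Fintype.piFinset fun _ : Fin m => D).filter (Rainbow c)).card : ℕ) : ℝ) +
      (F.card : ℝ) =
      (D.card : ℝ) ^ m := by rw [hF]; exact_mod_cast hsplit
  have : 6 * (m : ℝ) ^ 4 * cherryDensity c D * (D.card : ℝ) ^ m ≤ 1 * (D.card : ℝ) ^ m := by
    gcongr
  linarith

open Classical in
/-- In a set of two or more elements, at least half of the pairs are rainbow. -/
theorem card_pairs_le_two_mul_rainbow (c : α → α → L) {D : Finset α} (hD : 2 ≤ D.card) :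
    (D.card : ℝ) ^ 2 ≤
      2 * (((Fintype.piFinset fun _ : Fin 2 => D).filter (Rainbow c)).card : ℝ) := by
  have h : D.offDiag.card ≤ ((Fintype.piFinset fun _ : Fin 2 => D).filter (Rainbow c)).card := by
    apply Finset.card_le_card_of_injOn (fun x => ![x.1, x.2])
    · rintro ⟨x, y⟩ hx
      simp only [Finset.mem_coe, Finset.mem_offDiag] at hx
      simp only [Finset.coe_filter, Fintype.mem_piFinset, Set.mem_ofPred_eq]
      refine ⟨fun i => by fin_cases i <;> simp [hx], ?_, ?_⟩
      · intro i j; fin_cases i <;> fin_cases j <;> simp [hx.2.2, Ne.symm hx.2.2]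
      · intro i j i' j' h h' _
        omega
    · rintro ⟨x, y⟩ _ ⟨x', y'⟩ _ h
      have h0 := congrFun h 0
      have h1 := congrFun h 1
      simp at h0 h1
      simp [h0, h1]
  rw [Finset.offDiag_card] at h
  have h2 : D.card * D.card ≤ 2 * (D.card * D.card - D.card) := by
    have : 2 * D.card ≤ D.card * D.card := Nat.mul_le_mul_right _ hD
    omega
  rw [sq]
  exact_mod_cast h2.trans (Nat.mul_le_mul_left 2 h)

theorem sq_le_four_mul_card_colorsOn {c : α → α → L} {m : ℕ} (hm : 2 ≤ m) {T : Fin m → α}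
    (hT : Rainbow c T) : m ^ 2 ≤ 4 * (colorsOn c (Finset.univ.image T)).card := by
  have h : ((Finset.univ : Finset (Fin m × Fin m)).filter fun x => x.1 < x.2).card ≤
      (colorsOn c (Finset.univ.image T)).card := by
    apply Finset.card_le_card_of_injOn (fun x => c (T x.1) (T x.2))
    · rintro ⟨i, j⟩ hx
      simp only [Finset.coe_filter, Finset.mem_univ, true_and, Set.mem_ofPred_eq] at hx
      simp only [colorsOn, Finset.coe_image, Set.mem_image, Finset.mem_coe, Finset.mem_offDiag]
      exact ⟨(T i, T j), ⟨by simp, by simp, fun h => hx.ne (hT.1 h)⟩, rfl⟩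
    · rintro ⟨i, j⟩ hx ⟨i', j'⟩ hx' h
      simp only [Finset.coe_filter, Finset.mem_univ, true_and, Set.mem_ofPred_eq] at hx hx'
      have := hT.2 i j i' j' hx hx' h
      simp [this]
  have hsymm : ((Finset.univ : Finset (Fin m × Fin m)).filter fun x => x.2 < x.1).card =
      ((Finset.univ : Finset (Fin m × Fin m)).filter fun x => x.1 < x.2).card := by
    apply Finset.card_bij' (fun x _ => x.swap) (fun x _ => x.swap) <;> simp
  have hoff : (Finset.univ : Finset (Fin m)).offDiag ⊆
      ((Finset.univ : Finset (Fin m × Fin m)).filter fun x => x.1 < x.2) ∪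
      ((Finset.univ : Finset (Fin m × Fin m)).filter fun x => x.2 < x.1) := by
    rintro ⟨i, j⟩ hx
    simp only [Finset.mem_offDiag] at hx
    simpa using lt_or_gt_of_ne hx.2.2
  have h1 := (Finset.card_le_card hoff).trans (Finset.card_union_le _ _)
  rw [Finset.offDiag_card, hsymm] at h1
  simp only [Finset.card_univ, Fintype.card_fin] at h1
  have : 2 * m ≤ m * m := Nat.mul_le_mul_right _ hm
  rw [sq]
  omega

end Rainbow

/-! ### Even-chromatic `K₄`: an extremal set and dependent random choice -/

section TwistedK4

set_option linter.unusedSectionVars false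

variable {α L : Type*} [DecidableEq α] [DecidableEq L] [Fintype L]

open Classical in
/-- Dependent random choice: among the tuples of `Y` with a property that is shared by half of the
tuples in every large subset, some have many common neighbours of large degree. -/
theorem exists_tuple_common_neighbours {X Y : Finset α} (R : α → α → Prop) {q : ℝ} {m : ℕ}
    (good : (Fin m → α) → Prop) (hX : X.Nonempty) (hY : Y.Nonempty) (hq : 0 < q)
    (hR : q * X.card * Y.card ≤ ∑ x ∈ X, ((Y.filter fun y => R x y).card : ℝ))
    (hgood : ∀ D ⊆ Y, q / 2 * Y.card ≤ (D.card : ℝ) →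
      (D.card : ℝ) ^ m ≤ 2 * (((Fintype.piFinset fun _ : Fin m => D).filter good).card : ℝ)) :
    ∃ T : Fin m → α, (∀ i, T i ∈ Y) ∧ good T ∧ ∃ X' ⊆ X, (∀ x ∈ X', ∀ i, R x (T i)) ∧
      (∀ x ∈ X', q / 2 * Y.card ≤ ((Y.filter fun y => R x y).card : ℝ)) ∧
      (X.card : ℝ) * (q / 2) ^ (m + 1) / 2 ≤ X'.card := by
  have hXc : 0 < (X.card : ℝ) := by exact_mod_cast hX.card_pos
  have hYc : 0 < (Y.card : ℝ) := by exact_mod_cast hY.card_pos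
  set N : α → Finset α := fun x => Y.filter fun y => R x y with hN
  set X1 := X.filter fun x => q / 2 * Y.card ≤ ((N x).card : ℝ) with hX1
  -- Vertices of degree below `q / 2 * |Y|` contribute at most half of the related pairs.
  have hX1c : (X.card : ℝ) * (q / 2) ≤ X1.card := by
    have h1 : ∑ x ∈ X, ((N x).card : ℝ) ≤
        (X1.card : ℝ) * Y.card + X.card * (q / 2 * Y.card) := by
      rw [← Finset.sum_filter_add_sum_filter_not X
        (fun x => q / 2 * Y.card ≤ ((N x).card : ℝ))]
      refine add_le_add ?_ ?_
      · calc _ ≤ ∑ x ∈ X1, (Y.card : ℝ) := by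
              refine Finset.sum_le_sum fun x _ => ?_
              exact_mod_cast Finset.card_filter_le _ _
          _ = _ := by simp
      · calc _ ≤ ∑ x ∈ X.filter (fun x => ¬ q / 2 * Y.card ≤ ((N x).card : ℝ)),
                q / 2 * (Y.card : ℝ) := by
              refine Finset.sum_le_sum fun x hx => ?_
              exact (not_le.mp (Finset.mem_filter.mp hx).2).le
          _ ≤ _ := by
              rw [Finset.sum_const, nsmul_eq_mul]
              gcongr
              exact Finset.filter_subset _ _
    have h2 : (X.card : ℝ) * (q / 2) * Y.card ≤ X1.card * Y.card := by linarith
    exact le_of_mul_le_mul_right h2 hYc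
  by_contra hcon
  push Not at hcon
  set G := (Fintype.piFinset fun _ : Fin m => Y).filter good with hG
  have hlt : ∀ T ∈ G, ((X1.filter fun x => ∀ i, R x (T i)).card : ℝ) <
      (X.card : ℝ) * (q / 2) ^ (m + 1) / 2 := by
    intro T hT
    rw [hG, Finset.mem_filter, Fintype.mem_piFinset] at hT
    refine hcon T hT.1 hT.2 _ ((Finset.filter_subset _ _).trans (Finset.filter_subset _ _)) ?_ ?_
    · intro x hx
      exact (Finset.mem_filter.mp hx).2
    · intro x hx
      exact (Finset.mem_filter.mp (Finset.mem_filter.mp hx).1).2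
  -- Count pairs of a good tuple and a common neighbour from `X1`. From the side of `X1`, at least
  -- half of the tuples in each neighbourhood are good; from the side of the tuples, each would have
  -- too few common neighbours.
  have hsum : ∑ T ∈ G, ((X1.filter fun x => ∀ i, R x (T i)).card : ℝ) =
      ∑ x ∈ X1, (((Fintype.piFinset fun _ : Fin m => N x).filter good).card : ℝ) := by
    have := Finset.sum_card_bipartiteAbove_eq_sum_card_bipartiteBelow
      (s := G) (t := X1) (fun T x => ∀ i, R x (T i))
    unfold Finset.bipartiteAbove Finset.bipartiteBelow at this
    have h2 : ∀ x, (G.filter fun T => ∀ i, R x (T i)) =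
        (Fintype.piFinset fun _ : Fin m => N x).filter good := by
      intro x
      ext T
      simp only [hG, hN, Finset.mem_filter, Fintype.mem_piFinset]
      constructor
      · rintro ⟨⟨h1, h2⟩, h3⟩
        exact ⟨fun i => ⟨h1 i, h3 i⟩, h2⟩
      · rintro ⟨h1, h2⟩
        exact ⟨⟨fun i => (h1 i).1, h2⟩, fun i => (h1 i).2⟩
    simp_rw [h2] at this
    exact_mod_cast this
  have hlow : (X1.card : ℝ) * ((q / 2 * Y.card) ^ m / 2) ≤
      ∑ x ∈ X1, (((Fintype.piFinset fun _ : Fin m => N x).filter good).card : ℝ) := by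
    rw [← nsmul_eq_mul, ← Finset.sum_const]
    refine Finset.sum_le_sum fun x hx => ?_
    have hx2 := (Finset.mem_filter.mp hx).2
    have := hgood (N x) (Finset.filter_subset _ _) hx2
    have h3 : (q / 2 * (Y.card : ℝ)) ^ m ≤ ((N x).card : ℝ) ^ m := by gcongr
    linarith
  have hpos : 0 < (X1.card : ℝ) * ((q / 2 * Y.card) ^ m / 2) := by
    have : 0 < (X1.card : ℝ) := lt_of_lt_of_le (by positivity) hX1c
    positivity
  have hGne : G.Nonempty := by
    by_contra h
    rw [Finset.not_nonempty_iff_eq_empty] at h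
    rw [h, Finset.sum_empty] at hsum
    linarith
  have hup : ∑ T ∈ G, ((X1.filter fun x => ∀ i, R x (T i)).card : ℝ) <
      (Y.card : ℝ) ^ m * ((X.card : ℝ) * (q / 2) ^ (m + 1) / 2) := by
    refine (Finset.sum_lt_sum_of_nonempty hGne hlt).trans_le ?_
    rw [Finset.sum_const, nsmul_eq_mul]
    gcongr
    have : G.card ≤ Y.card ^ m := by
      refine (Finset.card_filter_le _ _).trans ?_
      rw [Fintype.card_piFinset]
      simp
    exact_mod_cast this
  have hfin : (Y.card : ℝ) ^ m * ((X.card : ℝ) * (q / 2) ^ (m + 1) / 2) ≤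
      (X1.card : ℝ) * ((q / 2 * Y.card) ^ m / 2) := by
    have : (Y.card : ℝ) ^ m * ((X.card : ℝ) * (q / 2) ^ (m + 1) / 2) =
        (X.card : ℝ) * (q / 2) * ((q / 2 * Y.card) ^ m / 2) := by
      rw [mul_pow]; ring
    rw [this]
    gcongr
  linarith

/-- Opposite edges of a `4`-cycle of `R` whose sides are in the same part have different colours. -/
def Separates (c : α → α → L) (R : α → α → Prop) : Prop :=
  ∀ u v x y, u ≠ v → x ≠ y → R u x → R u y → R v x → R v y → c u v ≠ c x y

theorem Separates.swap {c : α → α → L} {R : α → α → Prop} (h : Separates c R) :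
    Separates c fun x y => R y x :=
  fun u v x y huv hxy h1 h2 h3 h4 he => h x y u v hxy huv h1 h3 h2 h4 he.symm

theorem Separates.card_colorsOn_add_le {c : α → α → L} {R : α → α → Prop} (h : Separates c R)
    {A P Q : Finset α} (hP : P ⊆ A) (hQ : Q ⊆ A) (hPQ : ∀ x ∈ P, ∀ y ∈ Q, R x y) :
    (colorsOn c P).card + (colorsOn c Q).card ≤ (colorsOn c A).card := by
  have hd : Disjoint (colorsOn c P) (colorsOn c Q) := by
    rw [Finset.disjoint_left]
    intro g hg hg'
    simp only [colorsOn, Finset.mem_image, Finset.mem_offDiag, Prod.exists] at hg hg'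
    obtain ⟨u, v, ⟨hu, hv, huv⟩, rfl⟩ := hg
    obtain ⟨x, y, ⟨hx, hy, hxy⟩, he⟩ := hg'
    exact h u v x y huv hxy (hPQ u hu x hx) (hPQ u hu y hy) (hPQ v hv x hx) (hPQ v hv y hy) he.symm
  rw [← Finset.card_union_of_disjoint hd]
  refine Finset.card_le_card (Finset.union_subset ?_ ?_) <;>
  exact Finset.image_subset_image (Finset.offDiag_mono (by assumption))

/-- Every vertex of `A` has a colour such that these colours make up a proportion of pairs that is
at least the cherry density. -/
theorem exists_popular_colors (c : α → α → L) [Nonempty L] {A : Finset α} (hA : A.Nonempty) :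
    ∃ γ : α → L, cherryDensity c A * A.card * A.card ≤
      ∑ x ∈ A, ((A.filter fun y => c x y = γ x).card : ℝ) := by
  have hmax : ∀ x, ∃ g, ∀ g', (colorNbhd c A x g').card ≤ (colorNbhd c A x g).card := fun x => by
    obtain ⟨g, _, hg⟩ := Finset.exists_max_image (Finset.univ : Finset L)
      (fun g => (colorNbhd c A x g).card) Finset.univ_nonempty
    exact ⟨g, fun g' => hg g' (Finset.mem_univ _)⟩
  choose γ hγ using hmax
  refine ⟨γ, ?_⟩
  have hAc : 0 < (A.card : ℝ) := by exact_mod_cast hA.card_pos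
  have h1 : cherries c A ≤ (∑ x ∈ A, (colorNbhd c A x (γ x)).card) * A.card := by
    rw [Finset.sum_mul]
    refine Finset.sum_le_sum fun x _ => ?_
    rw [← sum_card_colorNbhd c A x, Finset.mul_sum]
    refine Finset.sum_le_sum fun g _ => ?_
    rw [sq]
    exact Nat.mul_le_mul_right _ (hγ x g)
  have h2 : (cherries c A : ℝ) ≤ (∑ x ∈ A, ((colorNbhd c A x (γ x)).card : ℝ)) * A.card := by
    exact_mod_cast h1
  rw [cherries_eq_mul] at h2
  refine le_of_mul_le_mul_right ?_ hAc
  calc _ = cherryDensity c A * (A.card : ℝ) ^ 3 := by ring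
    _ ≤ _ := h2

/-- Tuples of length about `q ^ (-1 / 8)`: short enough to be mostly rainbow when the squared cherry
density is at most `8 * q`, since `(6 * m ^ 4) ^ 2 * 8 = 288 * m ^ 8`, and long enough to bound `1 /
q` by a polynomial in `m`. Taking the least `m` gives both. -/
theorem exists_tuple_length {q : ℝ} (hq : 0 < q) :
    ∃ m : ℕ, 2 ≤ m ∧ 1 / q < 288 * ((m : ℝ) + 1) ^ 8 ∧ (m = 2 ∨ 288 * (m : ℝ) ^ 8 * q ≤ 1) := by
  classical
  have hex : ∃ m : ℕ, 2 ≤ m ∧ 1 / q < 288 * ((m : ℝ) + 1) ^ 8 := by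
    obtain ⟨n, hn⟩ := exists_nat_gt (1 / q)
    refine ⟨n + 2, by omega, hn.trans_le ?_⟩
    have h1 : (1 : ℝ) ≤ ((n + 2 : ℕ) : ℝ) + 1 := by push_cast; linarith [n.cast_nonneg (α := ℝ)]
    have h2 := le_self_pow₀ h1 (n := 8) (by norm_num)
    push_cast at h1 h2 ⊢
    linarith [n.cast_nonneg (α := ℝ)]
  refine ⟨Nat.find hex, (Nat.find_spec hex).1, (Nat.find_spec hex).2, ?_⟩
  have h2 := (Nat.find_spec hex).1
  rcases h2.eq_or_lt with h | h
  · exact .inl h.symm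
  right
  have hmin := Nat.find_min hex (m := Nat.find hex - 1) (by omega)
  rw [not_and] at hmin
  have := hmin (by omega)
  rw [not_lt, Nat.cast_sub (by omega)] at this
  simp only [Nat.cast_one, sub_add_cancel] at this
  rwa [le_div_iff₀ hq] at this

/-- The gain from losing `t ≥ m ^ 2 / 4` colours beats the loss in size, whose logarithm is only of
order `m * log m`. The crude bound `1 / q ≤ 2 ^ (13 * m)` suffices; 520 is large enough for `13 * m
* (4 * m + 11) ≤ 520 * t`. -/
theorem one_div_pow_le_two_pow {q : ℝ} (hq : 0 < q) {m t : ℕ} (hm : 2 ≤ m)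
    (hqm : 1 / q < 288 * ((m : ℝ) + 1) ^ 8) (ht : m ^ 2 ≤ 4 * t) :
    1 ≤ ((2 : ℝ) ^ 520) ^ t * q ^ (4 * m + 11) := by
  have h1 : 288 * ((m : ℝ) + 1) ^ 8 ≤ 2 ^ (13 * m) := by
    have h2 : (m : ℝ) + 1 ≤ 2 ^ m := by exact_mod_cast Nat.lt_two_pow_self
    calc 288 * ((m : ℝ) + 1) ^ 8 ≤ 2 ^ 9 * (2 ^ m) ^ 8 := by gcongr; norm_num
      _ = 2 ^ (9 + m * 8) := by rw [← pow_mul, ← pow_add]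
      _ ≤ 2 ^ (13 * m) := pow_le_pow_right₀ (by norm_num) (by omega)
  have h2 : (1 / q) ^ (4 * m + 11) ≤ ((2 : ℝ) ^ 520) ^ t := by
    calc (1 / q) ^ (4 * m + 11) ≤ (2 ^ (13 * m)) ^ (4 * m + 11) := by
          gcongr; exact (hqm.trans_le h1).le
      _ = 2 ^ (13 * m * (4 * m + 11)) := by rw [← pow_mul]
      _ ≤ 2 ^ (520 * t) := by
          refine pow_le_pow_right₀ (by norm_num) ?_
          nlinarith
      _ = _ := by rw [pow_mul]
  rw [one_div, inv_pow] at h2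
  exact (inv_le_iff_one_le_mul₀ (by positivity)).mp h2

/-- A pair of subsets of `A` that are not too small, such that the second one is
exceptionally poor in colours for its size, in terms of the parameter `q`. -/
structure DensePair (c : α → α → L) (A X Y : Finset α) (q : ℝ) : Prop where
  pos : 0 < q
  le_half : q ≤ 1 / 2
  left_subset : X ⊆ A
  right_subset : Y ⊆ A
  left_card : q ^ 2 * A.card ≤ X.card
  right_card : q ^ 2 * A.card ≤ Y.card
  few_colors : cherryDensity c A ^ 2 * A.card * (2 ^ 520) ^ (colorsOn c Y).card ≤
    Y.card * (2 ^ 520) ^ (colorsOn c A).card * (2 * q) ^ 2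

open Classical in
-- Extremality of `A` turns scarcity of colours on `Y` into small cherry density of all its large
-- subsets. Hence a rainbow tuple of `Y` has many common neighbours in `X`, and these lose all
-- colours of the tuple. They become the second set of the next pair, with the roles of the sides
-- exchanged.
theorem DensePair.exists_next {c : α → α → L} (hc : ∀ x y, c x y = c y x) {A : Finset α}
    (hA : A.Nonempty) (hcard : 32 * (Fintype.card L : ℝ) ^ 3 ≤ A.card)
    (hmax : ∀ D ⊆ A, D.Nonempty →
      cherryDensity c D ^ 2 * D.card * (2 ^ 520) ^ (colorsOn c A).card ≤
        cherryDensity c A ^ 2 * A.card * (2 ^ 520) ^ (colorsOn c D).card)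
    {X Y : Finset α} {q : ℝ} (h : DensePair c A X Y q) {R : α → α → Prop} (hR : Separates c R)
    (hden : q * X.card * Y.card ≤ ∑ x ∈ X, ((Y.filter fun y => R x y).card : ℝ)) :
    1 ≤ 2 * q * Fintype.card L ∧ ∃ X' q', q' ≤ q / 2 ∧ DensePair c A Y X' q' ∧
      q' * Y.card * X'.card ≤ ∑ y ∈ Y, ((X'.filter fun x => R x y).card : ℝ) := by
  obtain ⟨hq, hqh, hXA, hYA, hXc, hYc, hfew⟩ := h
  have ha : 0 < (A.card : ℝ) := by exact_mod_cast hA.card_pos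
  have hX : X.Nonempty := by
    rw [← Finset.card_pos, ← Nat.cast_pos (α := ℝ)]
    exact lt_of_lt_of_le (by positivity) hXc
  have hYpos : 0 < (Y.card : ℝ) := lt_of_lt_of_le (by positivity) hYc
  have hY : Y.Nonempty := by
    rw [← Finset.card_pos, ← Nat.cast_pos (α := ℝ)]
    exact hYpos
  obtain ⟨C, hC⟩ : ∃ C : ℝ, C = 2 ^ 520 := ⟨_, rfl⟩
  have hC1 : 1 ≤ C := by rw [hC]; exact one_le_pow₀ (by norm_num)
  have hC0 : 0 < C := one_pos.trans_le hC1
  rw [← hC] at hfew hmax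
  set p := cherryDensity c A with hp
  have hp0 : 0 ≤ p := cherryDensity_nonneg c A
  have hp1 : p ≤ 1 := cherryDensity_le_one c A
  have hCA : 0 < C ^ (colorsOn c A).card := by positivity
  have hsub : ∀ D ⊆ Y, q / 2 * Y.card ≤ (D.card : ℝ) → cherryDensity c D ^ 2 ≤ 8 * q := by
    intro D hD hDc
    have hDne : D.Nonempty := by
      rw [← Finset.card_pos, ← Nat.cast_pos (α := ℝ)]
      exact lt_of_lt_of_le (by positivity) hDc
    have h1 := hmax D (hD.trans hYA) hDne
    have h2 : C ^ (colorsOn c D).card ≤ C ^ (colorsOn c Y).card :=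
      pow_le_pow_right₀ hC1 (Finset.card_le_card
        (Finset.image_subset_image (Finset.offDiag_mono hD)))
    have h3 : cherryDensity c D ^ 2 * (q / 2 * Y.card) * C ^ (colorsOn c A).card ≤
        Y.card * C ^ (colorsOn c A).card * (2 * q) ^ 2 := by
      calc _ ≤ cherryDensity c D ^ 2 * D.card * C ^ (colorsOn c A).card := by gcongr
        _ ≤ _ := h1
        _ ≤ p ^ 2 * A.card * C ^ (colorsOn c Y).card := by gcongr
        _ ≤ _ := hfew
    have h4 : cherryDensity c D ^ 2 * (Y.card * C ^ (colorsOn c A).card * q / 2) ≤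
        (8 * q) * (Y.card * C ^ (colorsOn c A).card * q / 2) := by linarith
    exact le_of_mul_le_mul_right h4 (by positivity)
  have hpY : cherryDensity c Y ≤ 2 * q := by
    have h1 := (hmax Y hYA hY).trans hfew
    have h2 : cherryDensity c Y ^ 2 * (Y.card * C ^ (colorsOn c A).card) ≤
        (2 * q) ^ 2 * (Y.card * C ^ (colorsOn c A).card) := by linarith
    exact le_of_sq_le_sq (le_of_mul_le_mul_right h2 (by positivity)) (by positivity)
  have hql : 1 ≤ 2 * q * Fintype.card L := by
    refine (one_le_card_mul_cherryDensity c hY).trans ?_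
    rw [mul_comm]
    gcongr
  refine ⟨hql, ?_⟩
  obtain ⟨m, hm, hqm, hm'⟩ := exists_tuple_length hq
  obtain ⟨T, hTY, hT, X', hX', hX'R, hX'deg, hX'c⟩ :=
    exists_tuple_common_neighbours R (Rainbow c) (m := m) hX hY hq hden (by
      intro D hD hDc
      -- For `m = 2` the cherry density may be too large for the union bound, but any two distinct
      -- vertices are rainbow; the lower bound on `|A|` ensures that `D` has two elements.
      rcases hm' with rfl | hm'
      · refine card_pairs_le_two_mul_rainbow c ?_
        have h1 : (1 : ℝ) ≤ (2 * q * Fintype.card L) ^ 3 := one_le_pow₀ hql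
        have h2 : (2 : ℝ) ≤ D.card := by
          calc (2 : ℝ) ≤ 2 * (2 * q * Fintype.card L) ^ 3 := by linarith
            _ = q / 2 * (q ^ 2 * (32 * (Fintype.card L : ℝ) ^ 3)) := by ring
            _ ≤ q / 2 * (q ^ 2 * A.card) := by gcongr
            _ ≤ q / 2 * Y.card := by gcongr
            _ ≤ _ := hDc
        exact_mod_cast h2
      · refine card_tuples_le_two_mul_rainbow hc ?_
        refine (sq_le_one_iff₀ (by have := cherryDensity_nonneg c D; positivity)).mp ?_
        calc (6 * (m : ℝ) ^ 4 * cherryDensity c D) ^ 2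
            = 36 * (m : ℝ) ^ 8 * cherryDensity c D ^ 2 := by ring
          _ ≤ 36 * (m : ℝ) ^ 8 * (8 * q) := by gcongr; exact hsub D hD hDc
          _ = 288 * (m : ℝ) ^ 8 * q := by ring
          _ ≤ 1 := hm')
  set t := (colorsOn c (Finset.univ.image T)).card with ht
  have hmt : m ^ 2 ≤ 4 * t := sq_le_four_mul_card_colorsOn hm hT
  have hTA : Finset.univ.image T ⊆ A := by
    intro y hy
    obtain ⟨i, _, rfl⟩ := Finset.mem_image.mp hy
    exact hYA (hTY i)
  have hκ : (colorsOn c X').card + t ≤ (colorsOn c A).card :=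
    hR.card_colorsOn_add_le (hX'.trans hXA) hTA (by
      intro x hx y hy
      obtain ⟨i, _, rfl⟩ := Finset.mem_image.mp hy
      exact hX'R x hx i)
  have hX'c2 : q ^ (2 * m + 5) * A.card ≤ X'.card := by
    refine le_trans ?_ hX'c
    have h1 : q ^ 2 ≤ q / 2 := by nlinarith
    calc q ^ (2 * m + 5) * A.card = q ^ 2 * A.card * (q ^ 2) ^ (m + 1) * q := by ring
      _ ≤ X.card * (q / 2) ^ (m + 1) * (1 / 2) := by gcongr
      _ = _ := by ring
  have hq1 : q ≤ 1 := by linarith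
  have hqq : q ^ (m + 3) ≤ q / 2 := by
    calc q ^ (m + 3) ≤ q ^ 2 := pow_le_pow_of_le_one hq.le hq1 (by omega)
      _ ≤ q / 2 := by nlinarith
  -- The exponent is such that `X'`, of size at least `q ^ (2 * m + 5) * |A|`, has size at least `q'
  -- ^ 2 * |A|`. Together with the factor `q' ^ 2` in `few_colors` this costs `q ^ (4 * m + 11)`.
  refine ⟨X', q ^ (m + 3), hqq, ⟨by positivity, by linarith, hYA, hX'.trans hXA, ?_, ?_, ?_⟩, ?_⟩
  · calc (q ^ (m + 3)) ^ 2 * A.card ≤ q ^ 2 * A.card := by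
          gcongr; linarith
      _ ≤ _ := hYc
  · calc (q ^ (m + 3)) ^ 2 * A.card = q ^ (2 * m + 6) * A.card := by ring
      _ ≤ q ^ (2 * m + 5) * A.card := by
        gcongr ?_ * _
        exact pow_le_pow_of_le_one hq.le hq1 (by omega)
      _ ≤ _ := hX'c2
  · rw [← hp, ← hC]
    have h1 : 1 ≤ C ^ t * q ^ (4 * m + 11) := by
      rw [hC]; exact one_div_pow_le_two_pow hq hm hqm hmt
    have hp2 : p ^ 2 ≤ 1 := pow_le_one₀ hp0 hp1
    calc p ^ 2 * A.card * C ^ (colorsOn c X').card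
        ≤ 1 * A.card * C ^ (colorsOn c X').card * 1 := by rw [mul_one]; gcongr
      _ ≤ 1 * A.card * C ^ (colorsOn c X').card * (4 * (C ^ t * q ^ (4 * m + 11))) := by
          gcongr; linarith
      _ = (q ^ (2 * m + 5) * A.card) * C ^ ((colorsOn c X').card + t) *
            (2 * q ^ (m + 3)) ^ 2 := by ring
      _ ≤ X'.card * C ^ (colorsOn c A).card * (2 * q ^ (m + 3)) ^ 2 := by gcongr
  · have hswap : ∑ y ∈ Y, ((X'.filter fun x => R x y).card : ℝ) =
        ∑ x ∈ X', ((Y.filter fun y => R x y).card : ℝ) := by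
      have := Finset.sum_card_bipartiteAbove_eq_sum_card_bipartiteBelow
        (s := X') (t := Y) (fun x y => R x y)
      unfold Finset.bipartiteAbove Finset.bipartiteBelow at this
      exact_mod_cast this.symm
    rw [hswap]
    calc q ^ (m + 3) * Y.card * X'.card ≤ q / 2 * Y.card * X'.card := by gcongr
      _ = ∑ x ∈ X', q / 2 * (Y.card : ℝ) := by rw [Finset.sum_const, nsmul_eq_mul]; ring
      _ ≤ _ := Finset.sum_le_sum hX'deg

open Classical in
/-- If a relation separates colours and is at least as dense as the monochromatic cherries of a
set, this set is not extremal for its cherry density, its size, and its number of colours. -/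
theorem not_extremal_of_separates {c : α → α → L} (hc : ∀ x y, c x y = c y x) {A : Finset α}
    (hA : A.Nonempty) (hcard : 32 * (Fintype.card L : ℝ) ^ 3 ≤ A.card)
    (hmax : ∀ D ⊆ A, D.Nonempty →
      cherryDensity c D ^ 2 * D.card * (2 ^ 520) ^ (colorsOn c A).card ≤
        cherryDensity c A ^ 2 * A.card * (2 ^ 520) ^ (colorsOn c D).card)
    {R : α → α → Prop} (hR : Separates c R)
    (hden : cherryDensity c A * A.card * A.card ≤
      ∑ x ∈ A, ((A.filter fun y => R x y).card : ℝ)) : False := by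
  have hp0 : 0 < cherryDensity c A := by
    have := one_le_card_mul_cherryDensity c hA
    by_contra h
    rw [(not_lt.mp h).antisymm (cherryDensity_nonneg c A)] at this
    norm_num at this
  have hp1 := cherryDensity_le_one c A
  have key : ∀ j : ℕ, ∃ X Y q, ∃ R : α → α → Prop, q ≤ (1 / 2 : ℝ) ^ j ∧ DensePair c A X Y q ∧
      Separates c R ∧
      q * X.card * Y.card ≤ ∑ x ∈ X, ((Y.filter fun y => R x y).card : ℝ) := by
    intro j
    induction j with
    | zero =>
      -- With `2 * q` equal to the cherry density of `A`, `few_colors` is an equality. Halving the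
      -- density ensures `q ≤ 1 / 2`.
      refine ⟨A, A, cherryDensity c A / 2, R, by simp; linarith,
        ⟨by linarith, by linarith, subset_rfl, subset_rfl, ?_, ?_, ?_⟩, hR, ?_⟩
      · exact mul_le_of_le_one_left (by positivity) (pow_le_one₀ (by positivity) (by linarith))
      · exact mul_le_of_le_one_left (by positivity) (pow_le_one₀ (by positivity) (by linarith))
      · generalize (2 ^ 520 : ℝ) = C
        exact le_of_eq (by ring)
      · refine le_trans ?_ hden
        gcongr
        linarith
    | succ j ih =>
      obtain ⟨X, Y, q, R, hq, hXY, hR, hden⟩ := ih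
      obtain ⟨-, X', q', hq', hd, hden'⟩ := hXY.exists_next hc hA hcard hmax hR hden
      refine ⟨Y, X', q', fun x y => R y x, ?_, hd, hR.swap, hden'⟩
      rw [pow_succ]
      linarith
  obtain ⟨j, hj⟩ := exists_pow_lt_of_lt_one (y := (1 / 2 : ℝ))
    (x := 1 / (2 * (Fintype.card L : ℝ) + 1)) (by positivity) (by norm_num)
  obtain ⟨X, Y, q, R, hq, hXY, hR, hden⟩ := key j
  have h1 := (hXY.exists_next hc hA hcard hmax hR hden).1
  have h2 := hq.trans_lt hj
  rw [lt_div_iff₀ (by positivity)] at h2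
  linarith [hXY.pos]

/-- Every colouring of a large set with few colours has four vertices `u, v, x, y` such that the
edges `ux, uy`, the edges `vx, vy` and the edges `uv, xy` have the same colour. -/
theorem exists_twisted_four [Fintype α] [Nonempty α] {c : α → α → L}
    (hc : ∀ x y, c x y = c y x) (hd : ∀ x y, c x x = c x y → x = y)
    (hcard : 32 * (Fintype.card L : ℝ) ^ 5 * (2 ^ 520) ^ Fintype.card L ≤ Fintype.card α) :
    ∃ u v x y, u ≠ v ∧ x ≠ y ∧ u ≠ x ∧ u ≠ y ∧ v ≠ x ∧ v ≠ y ∧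
      c u x = c u y ∧ c v x = c v y ∧ c u v = c x y := by
  by_contra hno
  push Not at hno
  obtain ⟨C, hC⟩ : ∃ C : ℝ, C = 2 ^ 520 := ⟨_, rfl⟩
  have hC1 : 1 ≤ C := by rw [hC]; exact one_le_pow₀ (by norm_num)
  have hC0 : 0 < C := one_pos.trans_le hC1
  have a0 : α := Classical.arbitrary α
  have : Nonempty L := ⟨c a0 a0⟩
  have hL : (1 : ℝ) ≤ Fintype.card L := by exact_mod_cast Fintype.card_pos
  obtain ⟨A, hAm, hA⟩ := Finset.exists_max_image
    ((Finset.univ : Finset (Finset α)).filter Finset.Nonempty)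
    (fun D => cherryDensity c D ^ 2 * D.card / C ^ (colorsOn c D).card)
    ⟨Finset.univ, by simp⟩
  have hAne : A.Nonempty := (Finset.mem_filter.mp hAm).2
  have hmax : ∀ D : Finset α, D.Nonempty →
      cherryDensity c D ^ 2 * D.card * C ^ (colorsOn c A).card ≤
        cherryDensity c A ^ 2 * A.card * C ^ (colorsOn c D).card := by
    intro D hD
    have := hA D (Finset.mem_filter.mpr ⟨Finset.mem_univ _, hD⟩)
    rwa [div_le_div_iff₀ (by positivity) (by positivity)] at this
  -- Compare `A` with the whole vertex set, whose cherry density is at least the inverse of the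
  -- number of colours.
  have hAcard : 32 * (Fintype.card L : ℝ) ^ 3 ≤ A.card := by
    have h1 := hmax Finset.univ Finset.univ_nonempty
    have h2 := one_le_card_mul_cherryDensity c (Finset.univ_nonempty (α := α))
    have h3 : C ^ (colorsOn c (Finset.univ : Finset α)).card ≤ C ^ Fintype.card L :=
      pow_le_pow_right₀ hC1 (Finset.card_le_univ _)
    have h4 : (1 : ℝ) ≤ C ^ (colorsOn c A).card := one_le_pow₀ hC1
    have h5 : cherryDensity c A ^ 2 ≤ 1 :=
      pow_le_one₀ (cherryDensity_nonneg c A) (cherryDensity_le_one c A)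
    have hL0 : (0 : ℝ) ≤ Fintype.card L := by positivity
    rw [Finset.card_univ] at h1
    rw [← hC] at hcard
    have hp0 := cherryDensity_nonneg c (Finset.univ : Finset α)
    have h6 : cherryDensity c (Finset.univ : Finset α) ^ 2 * Fintype.card α ≤
        A.card * C ^ Fintype.card L := by
      calc _ ≤ cherryDensity c (Finset.univ : Finset α) ^ 2 * Fintype.card α *
            C ^ (colorsOn c A).card := le_mul_of_one_le_right (by positivity) h4
        _ ≤ _ := h1
        _ ≤ 1 * A.card * C ^ Fintype.card L := by gcongr
        _ = _ := by ring
    have h7 : (1 : ℝ) ≤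
        (Fintype.card L * cherryDensity c (Finset.univ : Finset α)) ^ 2 := one_le_pow₀ h2
    have h8 : 32 * (Fintype.card L : ℝ) ^ 3 * C ^ Fintype.card L ≤
        A.card * C ^ Fintype.card L := by
      calc 32 * (Fintype.card L : ℝ) ^ 3 * C ^ Fintype.card L
          ≤ 32 * (Fintype.card L : ℝ) ^ 3 * C ^ Fintype.card L *
            (Fintype.card L * cherryDensity c (Finset.univ : Finset α)) ^ 2 :=
            le_mul_of_one_le_right (by positivity) h7
        _ = cherryDensity c (Finset.univ : Finset α) ^ 2 *
            (32 * (Fintype.card L : ℝ) ^ 5 * C ^ Fintype.card L) := by ring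
        _ ≤ cherryDensity c (Finset.univ : Finset α) ^ 2 * Fintype.card α := by gcongr
        _ ≤ _ := h6
    exact le_of_mul_le_mul_right h8 (by positivity)
  obtain ⟨γ, hγ⟩ := exists_popular_colors c hAne
  have hsep : Separates c fun x y => c x y = γ x := by
    intro u v x y huv hxy h1 h2 h3 h4 he
    have e1 : c u x = c u y := h1.trans h2.symm
    have e2 : c v x = c v y := h3.trans h4.symm
    -- The four vertices are distinct because a diagonal pair never shares its colour with another
    -- pair at the same vertex.
    refine hno u v x y huv hxy ?_ ?_ ?_ ?_ e1 e2 he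
    · rintro rfl; exact hxy (hd _ _ e1)
    · rintro rfl; exact hxy (hd _ _ e1.symm).symm
    · rintro rfl; exact hxy (hd _ _ e2)
    · rintro rfl; exact hxy (hd _ _ e2.symm).symm
  rw [hC] at hmax
  refine not_extremal_of_separates hc hAne hAcard (fun D _ hD => hmax D hD) hsep ?_
  convert hγ

end TwistedK4

/-! ### Dependent random choice in a single colour -/

section CommonNeighbours

set_option linter.unusedSectionVars false

variable {α L W : Type*} [DecidableEq α] [DecidableEq L] [Fintype L]

/-- The vertices of `A` joined in colour `g` to all vertices of the tuple `T`. -/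
noncomputable def commonNbhd (χ : Sym2 α → L) (A : Finset α) (T : W → α) (g : L) : Finset α :=
  open Classical in A.filter fun y => ∀ w, T w ≠ y ∧ χ s(T w, y) = g

theorem mem_commonNbhd {χ : Sym2 α → L} {A : Finset α} {T : W → α} {g : L} {y : α} :
    y ∈ commonNbhd χ A T g ↔ y ∈ A ∧ ∀ w, T w ≠ y ∧ χ s(T w, y) = g := by
  simp [commonNbhd]

open Classical in
-- Double counting: `T` lies in the common neighbourhood of `β` exactly if `β` lies in that of `T`.
theorem sum_card_tuples_commonNbhd [Fintype W] (χ : Sym2 α → L) (A : Finset α) (g : L)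
    (F : Finset (W → α)) (hF : ∀ T ∈ F, ∀ w, T w ∈ A) (s : ℕ) :
    ∑ β ∈ Fintype.piFinset (fun _ : Fin s => A),
      (F.filter fun T => ∀ w, T w ∈ commonNbhd χ A β g).card =
    ∑ T ∈ F, (commonNbhd χ A T g).card ^ s := by
  have := Finset.sum_card_bipartiteAbove_eq_sum_card_bipartiteBelow
    (s := Fintype.piFinset (fun _ : Fin s => A)) (t := F)
    (fun β T => ∀ w, T w ∈ commonNbhd χ A β g)
  unfold Finset.bipartiteAbove Finset.bipartiteBelow at this
  rw [this]
  refine Finset.sum_congr rfl fun T hT => ?_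
  have h : (Fintype.piFinset (fun _ : Fin s => A)).filter
      (fun β => ∀ w, T w ∈ commonNbhd χ A β g) =
      Fintype.piFinset (fun _ : Fin s => commonNbhd χ A T g) := by
    ext β
    simp only [Finset.mem_filter, Fintype.mem_piFinset, mem_commonNbhd]
    constructor
    · rintro ⟨h1, h2⟩ i
      exact ⟨h1 i, fun w => ⟨((h2 w).2 i).1.symm, by rw [Sym2.eq_swap]; exact ((h2 w).2 i).2⟩⟩
    · intro h
      exact ⟨fun i => (h i).1, fun w => ⟨hF T hT w, fun i =>
        ⟨((h i).2 w).1.symm, by rw [Sym2.eq_swap]; exact ((h i).2 w).2⟩⟩⟩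
  rw [h, Fintype.card_piFinset]
  simp

theorem card_le_sum_commonNbhd (χ : Sym2 α → L) (A : Finset α) {v : α} (hv : v ∈ A) :
    A.card - 1 ≤ ∑ g, (commonNbhd χ A (fun _ : Unit => v) g).card := by
  rw [← Finset.card_erase_of_mem hv]
  rw [Finset.card_eq_sum_card_fiberwise (f := fun y => χ s(v, y)) (t := Finset.univ) (by simp)]
  refine Finset.sum_le_sum fun g _ => Finset.card_le_card fun y hy => ?_
  rw [Finset.mem_filter, Finset.mem_erase] at hy
  exact mem_commonNbhd.mpr ⟨hy.1.2, fun _ => ⟨hy.1.1.symm, hy.2⟩⟩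

theorem pow_le_sum_commonNbhd_pow (χ : Sym2 α → L) {A : Finset α} {v : α} (hv : v ∈ A)
    (hA : 2 ≤ A.card) (s : ℕ) :
    ((A.card : ℝ) / (2 * Fintype.card L)) ^ s ≤
      ∑ g, ((commonNbhd χ A (fun _ : Unit => v) g).card : ℝ) ^ s := by
  have hne : Nonempty L := ⟨χ s(v, v)⟩
  have hL : 0 < (Fintype.card L : ℝ) := by exact_mod_cast Fintype.card_pos
  have h1 : (A.card : ℝ) / 2 ≤ ∑ g, ((commonNbhd χ A (fun _ : Unit => v) g).card : ℝ) := by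
    have := card_le_sum_commonNbhd χ A hv
    have h2 : (A.card : ℝ) - 1 ≤ ∑ g, ((commonNbhd χ A (fun _ : Unit => v) g).card : ℝ) := by
      rw [← Nat.cast_one, ← Nat.cast_sub (by omega)]
      exact_mod_cast this
    have h3 : (2 : ℝ) ≤ A.card := by exact_mod_cast hA
    linarith
  obtain ⟨g, hg⟩ : ∃ g, (A.card : ℝ) / (2 * Fintype.card L) ≤
      ((commonNbhd χ A (fun _ : Unit => v) g).card : ℝ) := by
    by_contra hcon
    push Not at hcon
    have := Finset.sum_lt_sum_of_nonempty (s := (Finset.univ : Finset L)) Finset.univ_nonempty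
      (fun g _ => hcon g)
    rw [Finset.sum_const, Finset.card_univ, nsmul_eq_mul] at this
    have h4 : (Fintype.card L : ℝ) * (A.card / (2 * Fintype.card L)) = A.card / 2 := by
      field_simp
    linarith
  calc _ ≤ ((commonNbhd χ A (fun _ : Unit => v) g).card : ℝ) ^ s := by gcongr
    _ ≤ _ := Finset.single_le_sum
      (f := fun g => ((commonNbhd χ A (fun _ : Unit => v) g).card : ℝ) ^ s)
      (fun _ _ => by positivity) (Finset.mem_univ g)

open Classical in
/-- Dependent random choice: there is a large set all of whose tuples have a large common
neighbourhood in one and the same colour. -/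
theorem exists_subset_commonNbhd_large [Fintype W] [Nonempty W] (χ : Sym2 α → L) {A : Finset α}
    (hA : 2 ≤ A.card) (s : ℕ) {M : ℝ} (hM0 : 0 ≤ M)
    (hM : (A.card : ℝ) ^ Fintype.card W * M ^ s ≤ (A.card : ℝ) ^ s) :
    ∃ g, ∃ A' ⊆ A, (A.card : ℝ) / (2 * Fintype.card L) ^ (s + 1) - 1 ≤ A'.card ∧
      ∀ T : W → α, (∀ w, T w ∈ A') → M ≤ (commonNbhd χ A T g).card := by
  obtain ⟨v0, hv0⟩ : A.Nonempty := Finset.card_pos.mp (by omega)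
  have hne : Nonempty L := ⟨χ s(v0, v0)⟩
  have hL : 1 ≤ (Fintype.card L : ℝ) := by exact_mod_cast Fintype.card_pos
  have hN : 0 < (A.card : ℝ) := by exact_mod_cast (by omega : 0 < A.card)
  set bad : L → Finset (W → α) := fun g => (Fintype.piFinset fun _ : W => A).filter
    fun T => ((commonNbhd χ A T g).card : ℝ) < M with hbad
  set good : (Fin s → α) → L → Finset α := fun β g => commonNbhd χ A β g with hgood
  set badIn : (Fin s → α) → L → Finset (W → α) := fun β g =>
    (bad g).filter fun T => ∀ w, T w ∈ commonNbhd χ A β g with hbadIn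
  -- Each vertex has at least `|A| / (2 * |L|)` neighbours in some colour, so that it is a common
  -- neighbour of many `β` in that colour.
  have hsum_good : (A.card : ℝ) * (A.card / (2 * Fintype.card L)) ^ s ≤
      ∑ g, ∑ β ∈ Fintype.piFinset (fun _ : Fin s => A), ((good β g).card : ℝ) := by
    have h1 : ∀ g, ∑ β ∈ Fintype.piFinset (fun _ : Fin s => A), ((good β g).card : ℝ) =
        ∑ v ∈ A, ((commonNbhd χ A (fun _ : Unit => v) g).card : ℝ) ^ s := by
      intro g
      have h2 := sum_card_tuples_commonNbhd χ A g (Fintype.piFinset fun _ : Unit => A)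
        (fun T hT => Fintype.mem_piFinset.mp hT) s
      have h3 : ∀ β : Fin s → α, ((Fintype.piFinset fun _ : Unit => A).filter
          fun T => ∀ w, T w ∈ commonNbhd χ A β g).card = (good β g).card := by
        intro β
        refine Finset.card_bij' (fun T _ => T ()) (fun v _ _ => v) ?_ ?_ ?_ ?_
        · intro T hT; exact (Finset.mem_filter.mp hT).2 ()
        · intro v hv
          rw [Finset.mem_filter, Fintype.mem_piFinset]
          exact ⟨fun _ => (mem_commonNbhd.mp hv).1, fun _ => hv⟩
        · intro T _; rfl
        · intro v _; rfl
      simp_rw [h3] at h2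
      have h4 : ∑ T ∈ Fintype.piFinset (fun _ : Unit => A), (commonNbhd χ A T g).card ^ s =
          ∑ v ∈ A, (commonNbhd χ A (fun _ : Unit => v) g).card ^ s := by
        refine Finset.sum_bij' (fun T _ => T ()) (fun v _ _ => v) ?_ ?_ ?_ ?_ ?_
        · intro T hT; exact Fintype.mem_piFinset.mp hT ()
        · intro v hv; exact Fintype.mem_piFinset.mpr fun _ => hv
        · intro T _; rfl
        · intro v _; rfl
        · intro T _; rfl
      rw [h4] at h2
      exact_mod_cast h2
    simp_rw [h1]
    rw [Finset.sum_comm, ← nsmul_eq_mul, ← Finset.sum_const]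
    exact Finset.sum_le_sum fun v hv => pow_le_sum_commonNbhd_pow χ hv hA s
  -- A bad tuple is in the common neighbourhood of at most `M ^ s` tuples `β`, so on average there
  -- is at most one bad tuple per pair `(g, β)`.
  have hsum_bad : ∑ g, ∑ β ∈ Fintype.piFinset (fun _ : Fin s => A), ((badIn β g).card : ℝ) ≤
      Fintype.card L * (A.card : ℝ) ^ s := by
    rw [← nsmul_eq_mul, ← Finset.card_univ, ← Finset.sum_const]
    refine Finset.sum_le_sum fun g _ => ?_
    have h2 := sum_card_tuples_commonNbhd χ A g (bad g)
      (fun T hT => Fintype.mem_piFinset.mp (Finset.mem_filter.mp hT).1) s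
    have h3 : ∑ β ∈ Fintype.piFinset (fun _ : Fin s => A), ((badIn β g).card : ℝ) =
        ∑ T ∈ bad g, ((commonNbhd χ A T g).card : ℝ) ^ s := by exact_mod_cast h2
    rw [h3]
    refine le_trans ?_ hM
    calc _ ≤ ∑ T ∈ bad g, M ^ s := by
          refine Finset.sum_le_sum fun T hT => ?_
          have := (Finset.mem_filter.mp hT).2.le
          gcongr
      _ = (bad g).card * M ^ s := by rw [Finset.sum_const, nsmul_eq_mul]
      _ ≤ _ := by
          gcongr
          have : (bad g).card ≤ A.card ^ Fintype.card W := by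
            refine (Finset.card_filter_le _ _).trans ?_
            rw [Fintype.card_piFinset]
            simp
          exact_mod_cast this
  obtain ⟨g, β, hβ⟩ : ∃ g, ∃ β : Fin s → α,
      (A.card : ℝ) / (2 * Fintype.card L) ^ (s + 1) - 1 ≤
        (good β g).card - (badIn β g).card := by
    by_contra hcon
    push Not at hcon
    have h1 : ∑ g : L, ∑ β ∈ Fintype.piFinset (fun _ : Fin s => A),
        (((good β g).card : ℝ) - (badIn β g).card) <
        ∑ g : L, ∑ β ∈ Fintype.piFinset (fun _ : Fin s => A),
          ((A.card : ℝ) / (2 * Fintype.card L) ^ (s + 1) - 1) := by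
      refine Finset.sum_lt_sum_of_nonempty Finset.univ_nonempty fun g _ => ?_
      exact Finset.sum_lt_sum_of_nonempty
        ⟨fun _ => v0, Fintype.mem_piFinset.mpr fun _ => hv0⟩ fun β _ => hcon g β
    simp only [Finset.sum_sub_distrib, Finset.sum_const, nsmul_eq_mul, Finset.card_univ,
      Fintype.card_piFinset, Finset.prod_const, Fintype.card_fin] at h1
    have h2 : (Fintype.card L : ℝ) * ((A.card ^ s : ℕ) *
        ((A.card : ℝ) / (2 * Fintype.card L) ^ (s + 1))) ≤
        A.card * (A.card / (2 * Fintype.card L)) ^ s := by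
      have : (Fintype.card L : ℝ) * ((A.card ^ s : ℕ) *
        ((A.card : ℝ) / (2 * Fintype.card L) ^ (s + 1))) =
        A.card * (A.card / (2 * Fintype.card L)) ^ s * (1 / 2) := by
        rw [div_pow]; push_cast; field_simp; ring
      rw [this]
      exact mul_le_of_le_one_right (by positivity) (by norm_num)
    push_cast at h1 h2
    linarith
  obtain ⟨w0⟩ := ‹Nonempty W›
  -- Deleting one entry of every bad tuple destroys them all.
  refine ⟨g, good β g \ (badIn β g).image (fun T => T w0),
    fun v hv => (mem_commonNbhd.mp (Finset.mem_sdiff.mp hv).1).1, hβ.trans ?_, ?_⟩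
  · have h1 := Finset.le_card_sdiff ((badIn β g).image fun T => T w0) (good β g)
    have h2 : ((badIn β g).image fun T => T w0).card ≤ (badIn β g).card := Finset.card_image_le
    rw [sub_le_iff_le_add]
    exact_mod_cast (by omega : (good β g).card ≤
      (good β g \ (badIn β g).image fun T => T w0).card + (badIn β g).card)
  · intro T hT
    by_contra hlt
    have h1 : ∀ w, T w ∈ commonNbhd χ A β g := fun w => (Finset.mem_sdiff.mp (hT w)).1
    have h2 : T ∈ badIn β g := by
      rw [hbadIn, Finset.mem_filter, hbad, Finset.mem_filter, Fintype.mem_piFinset]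
      exact ⟨⟨fun w => (mem_commonNbhd.mp (h1 w)).1, not_le.mp hlt⟩, h1⟩
    exact (Finset.mem_sdiff.mp (hT w0)).2 (Finset.mem_image_of_mem _ h2)

theorem eventually_log_pow_le_rpow {ε : ℝ} (hε : 0 < ε) (s : ℕ) :
    ∀ᶠ n : ℕ in atTop, 2 * (2 * Real.log n) ^ s ≤ (n : ℝ) ^ ε := by
  have h := (isLittleO_log_rpow_rpow_atTop (s : ℝ) hε).comp_tendsto tendsto_natCast_atTop_atTop
  have h2 := h.def (c := 1 / (2 * 2 ^ s)) (by positivity)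
  filter_upwards [h2, eventually_ge_atTop 1] with n hn hn1
  have hlog : 0 ≤ Real.log n := Real.log_natCast_nonneg n
  simp only [Function.comp_apply, Real.rpow_natCast, Real.norm_eq_abs] at hn
  rw [abs_of_nonneg (by positivity), abs_of_nonneg (by positivity), one_div_mul_eq_div,
    le_div_iff₀ (by positivity)] at hn
  rw [mul_pow]
  linarith

/-- Dependent random choice for few colours. -/
theorem exists_subset_commonNbhd_rpow (W : Type*) [Fintype W] [Nonempty W] {ε : ℝ} (hε : 0 < ε)
    (hε1 : ε ≤ 1) : ∃ n₀ : ℕ, ∀ (α L : Type) [DecidableEq α] [DecidableEq L] [Fintype L] (χ : Sym2 α → L)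
      (A : Finset α), n₀ ≤ A.card → (Fintype.card L : ℝ) ≤ Real.log A.card →
      ∃ g, ∃ A' ⊆ A, (A.card : ℝ) ^ (1 - ε) ≤ A'.card ∧
        ∀ T : W → α, (∀ w, T w ∈ A') → (A.card : ℝ) ^ (1 - ε) ≤ (commonNbhd χ A T g).card := by
  -- This `s` gives `N ^ |W| * N ^ ((1 - ε) * s) ≤ N ^ s`, while the loss `(2 * |L|) ^ (s + 1)` is
  -- polylogarithmic.
  obtain ⟨s, hs⟩ := exists_nat_ge ((Fintype.card W : ℝ) / ε)
  rw [div_le_iff₀ hε] at hs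
  obtain ⟨n₀, hn₀⟩ := ((eventually_log_pow_le_rpow hε (s + 1)).and
    (eventually_ge_atTop 2)).exists_forall_of_atTop
  refine ⟨n₀, fun α L _ _ _ χ A hA hk => ?_⟩
  obtain ⟨h1, h2⟩ := hn₀ A.card hA
  have hN : (2 : ℝ) ≤ A.card := by exact_mod_cast h2
  have hN0 : (0 : ℝ) < A.card := by linarith
  have hlog : 0 ≤ Real.log A.card := Real.log_natCast_nonneg _
  have hL : 0 < (Fintype.card L : ℝ) := by
    obtain ⟨v0, hv0⟩ : A.Nonempty := Finset.card_pos.mp (by omega)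
    have hne : Nonempty L := ⟨χ s(v0, v0)⟩
    exact_mod_cast Fintype.card_pos
  obtain ⟨g, A', hA', hc, hT⟩ := exists_subset_commonNbhd_large (W := W) χ h2 s
    (M := (A.card : ℝ) ^ (1 - ε)) (by positivity) (by
      rw [← Real.rpow_natCast, ← Real.rpow_natCast, ← Real.rpow_natCast, ← Real.rpow_mul hN0.le,
        ← Real.rpow_add hN0]
      refine Real.rpow_le_rpow_of_exponent_le (by linarith) ?_
      linarith)
  refine ⟨g, A', hA', le_trans ?_ hc, hT⟩
  have hN1 : (A.card : ℝ) ^ (1 - ε) * (A.card : ℝ) ^ ε = A.card := by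
    rw [← Real.rpow_add hN0, sub_add_cancel, Real.rpow_one]
  have h3 : 2 * (2 * (Fintype.card L : ℝ)) ^ (s + 1) ≤ (A.card : ℝ) ^ ε := by
    refine le_trans ?_ h1
    gcongr
  have hD : 0 < (2 * (Fintype.card L : ℝ)) ^ (s + 1) := by positivity
  have h4 : 2 * (A.card : ℝ) ^ (1 - ε) ≤ (A.card : ℝ) / (2 * Fintype.card L) ^ (s + 1) := by
    rw [le_div_iff₀ hD]
    calc _ = (A.card : ℝ) ^ (1 - ε) * (2 * (2 * (Fintype.card L : ℝ)) ^ (s + 1)) := by ring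
      _ ≤ (A.card : ℝ) ^ (1 - ε) * (A.card : ℝ) ^ ε := by gcongr
      _ = _ := hN1
  have : 1 ≤ (A.card : ℝ) ^ (1 - ε) := Real.one_le_rpow (by linarith) (by linarith)
  linarith

end CommonNeighbours
-- Edge sets on which every colour is even
section EvenColored

variable {V : Type*} {α L : Type*}

/-- Every colour is found on an even number of the images of the edges in `F`. -/
def EvenColored (χ : Sym2 α → L) (f : V → α) (F : Finset (Sym2 V)) : Prop :=
  open Classical in ∀ g, Even (F.filter fun e => χ (e.map f) = g).card

theorem EvenColored.disjoint_union [DecidableEq V] {χ : Sym2 α → L} {f : V → α}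
    {F F' : Finset (Sym2 V)} (h : EvenColored χ f F) (h' : EvenColored χ f F')
    (hd : Disjoint F F') : EvenColored χ f (F ∪ F') := by
  classical
  intro g
  rw [Finset.filter_union, Finset.card_union_of_disjoint (Finset.disjoint_filter_filter hd)]
  exact (h g).add (h' g)

theorem EvenColored.congr {χ : Sym2 α → L} {f f' : V → α} {F : Finset (Sym2 V)}
    (h : EvenColored χ f F) (hf : ∀ e ∈ F, e.map f' = e.map f) : EvenColored χ f' F := by
  classical
  intro g
  have := h g
  rwa [Finset.filter_congr fun e he => by rw [← hf e he]] at this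

theorem evenColored_of_const {χ : Sym2 α → L} {f : V → α} {F : Finset (Sym2 V)} (hF : Even F.card)
    {g : L} (h : ∀ e ∈ F, χ (e.map f) = g) : EvenColored χ f F := by
  classical
  intro g'
  by_cases hg : g = g'
  · subst hg
    rwa [Finset.filter_true_of_mem h]
  · rw [Finset.filter_false_of_mem fun e he => by rw [h e he]; exact hg]
    simp

end EvenColored

/-! ### Edge counts of induced subgraphs, and joining unavoidable pieces -/

section EdgesIn

set_option linter.unusedSectionVars false

variable {V : Type*} [DecidableEq V]

/-- The edges of `H` with both ends in `S`. -/
noncomputable def edgesIn (H : SimpleGraph V) (S : Finset V) : Finset (Sym2 V) :=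
  open Classical in S.sym2.filter fun e => e ∈ H.edgeSet

/-- The edges of `H` with one end in `S` and the other one in `S'`, given as ordered pairs. -/
noncomputable def edgesBetween (H : SimpleGraph V) (S S' : Finset V) : Finset (V × V) :=
  open Classical in (S ×ˢ S').filter fun x => H.Adj x.1 x.2

theorem mk_mem_edgesIn {H : SimpleGraph V} {S : Finset V} {u v : V} :
    s(u, v) ∈ edgesIn H S ↔ u ∈ S ∧ v ∈ S ∧ H.Adj u v := by
  simp [edgesIn, and_assoc]

theorem mem_edgesBetween {H : SimpleGraph V} {S S' : Finset V} {x : V × V} :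
    x ∈ edgesBetween H S S' ↔ x.1 ∈ S ∧ x.2 ∈ S' ∧ H.Adj x.1 x.2 := by
  simp [edgesBetween, and_assoc]

theorem edgesIn_union (H : SimpleGraph V) (S S' : Finset V) :
    edgesIn H (S ∪ S') = (edgesIn H S ∪ edgesIn H S') ∪
      (edgesBetween H S S').image fun x => s(x.1, x.2) := by
  ext e
  induction e with | _ u v
  simp only [Finset.mem_union, mk_mem_edgesIn, Finset.mem_image, mem_edgesBetween, Prod.exists]
  constructor
  · rintro ⟨hu | hu, hv | hv, h⟩
    · exact .inl (.inl ⟨hu, hv, h⟩)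
    · exact .inr ⟨u, v, ⟨hu, hv, h⟩, rfl⟩
    · exact .inr ⟨v, u, ⟨hv, hu, h.symm⟩, Sym2.eq_swap⟩
    · exact .inl (.inr ⟨hu, hv, h⟩)
  · rintro ((⟨hu, hv, h⟩ | ⟨hu, hv, h⟩) | ⟨x, y, ⟨hx, hy, h⟩, he⟩)
    · exact ⟨.inl hu, .inl hv, h⟩
    · exact ⟨.inr hu, .inr hv, h⟩
    · rw [Sym2.eq_iff] at he
      rcases he with ⟨rfl, rfl⟩ | ⟨rfl, rfl⟩
      · exact ⟨.inl hx, .inr hy, h⟩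
      · exact ⟨.inr hy, .inl hx, h.symm⟩

theorem disjoint_edgesIn (H : SimpleGraph V) {S S' : Finset V} (hd : Disjoint S S') :
    Disjoint (edgesIn H S) (edgesIn H S') := by
  rw [Finset.disjoint_left]
  intro e
  induction e with | _ u v
  rw [mk_mem_edgesIn, mk_mem_edgesIn]
  rintro ⟨h, -⟩ ⟨h', -⟩
  exact Finset.disjoint_left.mp hd h h'

theorem disjoint_edgesIn_edgesBetween (H : SimpleGraph V) {S S' : Finset V}
    (hd : Disjoint S S') :
    Disjoint (edgesIn H S ∪ edgesIn H S') ((edgesBetween H S S').image fun x => s(x.1, x.2)) := by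
  rw [Finset.disjoint_right]
  intro e he he'
  obtain ⟨⟨u, v⟩, hx, rfl⟩ := Finset.mem_image.mp he
  rw [mem_edgesBetween] at hx
  rw [Finset.mem_union, mk_mem_edgesIn, mk_mem_edgesIn] at he'
  rcases he' with h | h
  · exact Finset.disjoint_left.mp hd h.2.1 hx.2.1
  · exact Finset.disjoint_left.mp hd hx.1 h.1

theorem card_image_edgesBetween (H : SimpleGraph V) {S S' : Finset V} (hd : Disjoint S S') :
    ((edgesBetween H S S').image fun x => s(x.1, x.2)).card = (edgesBetween H S S').card := by
  refine Finset.card_image_of_injOn ?_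
  rintro ⟨u, v⟩ hx ⟨u', v'⟩ hx' he
  rw [Finset.mem_coe, mem_edgesBetween] at hx hx'
  simp only [Sym2.eq_iff] at he
  rcases he with ⟨rfl, rfl⟩ | ⟨rfl, rfl⟩
  · rfl
  · exact (Finset.disjoint_left.mp hd hx.1 hx'.2.1).elim

theorem card_edgesIn_union (H : SimpleGraph V) {S S' : Finset V} (hd : Disjoint S S') :
    (edgesIn H (S ∪ S')).card =
      (edgesIn H S).card + (edgesIn H S').card + (edgesBetween H S S').card := by
  rw [edgesIn_union, Finset.card_union_of_disjoint (disjoint_edgesIn_edgesBetween H hd),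
    Finset.card_union_of_disjoint (disjoint_edgesIn H hd), card_image_edgesBetween H hd]

/-- The number of neighbours of `v` in `S`. -/
noncomputable def degreeIn (H : SimpleGraph V) (S : Finset V) (v : V) : ℕ :=
  open Classical in (S.filter fun u => H.Adj v u).card

theorem card_edgesBetween (H : SimpleGraph V) (S S' : Finset V) :
    (edgesBetween H S S').card = ∑ v ∈ S, degreeIn H S' v := by
  classical
  unfold edgesBetween degreeIn
  rw [Finset.card_filter, Finset.sum_product]
  refine Finset.sum_congr rfl fun v _ => ?_
  rw [Finset.card_filter]

theorem degreeIn_sdiff (H : SimpleGraph V) {S T : Finset V} {v : V} (h : ∀ u ∈ T, ¬ H.Adj v u) :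
    degreeIn H (S \ T) v = degreeIn H S v := by
  classical
  unfold degreeIn
  congr 1
  ext u
  simp only [Finset.mem_filter, Finset.mem_sdiff]
  exact ⟨fun hu => ⟨hu.1.1, hu.2⟩, fun hu => ⟨⟨hu.1, fun hT => h u hT hu.2⟩, hu.2⟩⟩

/-- Every colouring of a sufficiently large set with at most `b⁻¹ log N` colours, where `b > b₀` and
`N` is the size of the set, has an even-chromatic copy of the subgraph of `H` induced by `S`. -/
def Unavoidable (b₀ : ℝ) (H : SimpleGraph V) (S : Finset V) : Prop :=
  ∀ b > b₀, ∃ n₀ : ℕ, ∀ (α L : Type) [Fintype L] (χ : Sym2 α → L) (A : Finset α),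
    n₀ ≤ A.card → b * Fintype.card L ≤ Real.log A.card →
    ∃ f : V → α, Set.InjOn f S ∧ (∀ v ∈ S, f v ∈ A) ∧ EvenColored χ f (edgesIn H S)

theorem unavoidable_of_edgesIn_eq_empty {b₀ : ℝ} {H : SimpleGraph V} {S : Finset V}
    (h : edgesIn H S = ∅) : Unavoidable b₀ H S := by
  classical
  intro b _
  refine ⟨S.card + 1, fun α L _ χ A hA _ => ?_⟩
  obtain ⟨a0, ha0⟩ : A.Nonempty := Finset.card_pos.mp (by omega)
  obtain ⟨e⟩ : Nonempty (S ↪ A) := Function.Embedding.nonempty_of_card_le (by simp; omega)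
  refine ⟨fun v => if h : v ∈ S then e ⟨v, h⟩ else a0, ?_, ?_, ?_⟩
  · intro u hu v hv huv
    have hu' : u ∈ S := hu
    have hv' : v ∈ S := hv
    simp only [hu', hv', dif_pos] at huv
    exact congrArg Subtype.val (e.injective (Subtype.ext huv))
  · intro v hv
    simp [hv]
  · intro g
    simp [h]

/-- The edges between the two images all have one colour, which is harmless as their number is even.
Passing to sets of size `N ^ (1 - ε)` shrinks the logarithm by the factor `1 - ε`; since
`Unavoidable` only concerns `b > b₀`, this is absorbed with the same `b₀`. -/
theorem Unavoidable.union {b₀ : ℝ} (hb₀ : 1 ≤ b₀) {H : SimpleGraph V} {S S' : Finset V}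
    (hS : Unavoidable b₀ H S) (hS' : Unavoidable b₀ H S') (hd : Disjoint S S')
    (hne : S.Nonempty) (heven : Even (edgesBetween H S S').card) :
    Unavoidable b₀ H (S ∪ S') := by
  classical
  intro b hb
  have : Nonempty S := hne.to_subtype
  -- An intermediate constant; below, `1 - ε = b' / b` turns the bound with `b` on `A` into the
  -- bound with `b'` on sets of size `N ^ (1 - ε)`.
  set b' := (b + b₀) / 2 with hb'
  have hb'0 : b₀ < b' := by rw [hb']; linarith
  have hb'b : b' < b := by rw [hb']; linarith
  have hbpos : 0 < b := by linarith
  set ε := 1 - b' / b with hε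
  have hε0 : 0 < ε := by
    rw [hε, sub_pos, div_lt_one hbpos]; exact hb'b
  have hε1 : ε ≤ 1 := by
    rw [hε]; have : 0 ≤ b' / b := by positivity
    linarith
  have hε2 : 0 < 1 - ε := by
    rw [hε, sub_sub_cancel]; exact div_pos (by linarith) hbpos
  obtain ⟨n₁, h₁⟩ := hS b' hb'0
  obtain ⟨n₂, h₂⟩ := hS' b' hb'0
  obtain ⟨n₃, h₃⟩ := exists_subset_commonNbhd_rpow S hε0 hε1
  obtain ⟨n₄, h₄⟩ := (((tendsto_rpow_atTop hε2).comp tendsto_natCast_atTop_atTop).eventually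
    (eventually_ge_atTop ((max n₁ n₂ : ℕ) : ℝ))).exists_forall_of_atTop
  refine ⟨max (max n₃ n₄) 1, fun α L _ χ A hA hk => ?_⟩
  have hA3 : n₃ ≤ A.card := le_trans (by simp) hA
  have hA4 := h₄ A.card (le_trans (by simp) hA)
  have hA1 : 1 ≤ A.card := le_trans (by simp) hA
  have hN0 : (0 : ℝ) < A.card := by exact_mod_cast hA1
  have hk0 : (0 : ℝ) ≤ Fintype.card L := by positivity
  obtain ⟨g, A', hA', hA'c, hT⟩ := h₃ α L χ A hA3 (by nlinarith)
  have hlarge : ∀ B : Finset α, (A.card : ℝ) ^ (1 - ε) ≤ B.card →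
      max n₁ n₂ ≤ B.card ∧ b' * Fintype.card L ≤ Real.log B.card := by
    intro B hB
    constructor
    · have : ((max n₁ n₂ : ℕ) : ℝ) ≤ B.card := le_trans hA4 hB
      exact_mod_cast this
    · have h5 := Real.log_le_log (by positivity) hB
      rw [Real.log_rpow hN0] at h5
      refine le_trans ?_ h5
      rw [hε, sub_sub_cancel]
      calc b' * Fintype.card L = b' / b * (b * Fintype.card L) := by field_simp
        _ ≤ b' / b * Real.log A.card := by
          have : 0 ≤ b' / b := div_nonneg (by linarith) hbpos.le
          gcongr
  obtain ⟨f₁, hf₁, hf₁A, hf₁e⟩ := h₁ α L χ A' (le_trans (le_max_left _ _) (hlarge A' hA'c).1)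
    (hlarge A' hA'c).2
  have hB := hT (fun w : S => f₁ w) fun w => hf₁A w w.2
  obtain ⟨f₂, hf₂, hf₂B, hf₂e⟩ := h₂ α L χ _ (le_trans (le_max_right _ _) (hlarge _ hB).1)
    (hlarge _ hB).2
  have hf₂B' := fun v hv => mem_commonNbhd.mp (hf₂B v hv)
  set f : V → α := fun v => if v ∈ S then f₁ v else f₂ v with hf
  have hfS : ∀ v ∈ S, f v = f₁ v := fun v hv => by simp [hf, hv]
  have hfS' : ∀ v ∈ S', f v = f₂ v := fun v hv => by
    have : v ∉ S := Finset.disjoint_right.mp hd hv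
    simp [hf, this]
  refine ⟨f, ?_, ?_, ?_⟩
  · intro u hu v hv huv
    rw [Finset.mem_coe, Finset.mem_union] at hu hv
    rcases hu with hu | hu <;> rcases hv with hv | hv
    · rw [hfS u hu, hfS v hv] at huv
      exact hf₁ hu hv huv
    · rw [hfS u hu, hfS' v hv] at huv
      exact (((hf₂B' v hv).2 ⟨u, hu⟩).1 huv).elim
    · rw [hfS' u hu, hfS v hv] at huv
      exact (((hf₂B' u hu).2 ⟨v, hv⟩).1 huv.symm).elim
    · rw [hfS' u hu, hfS' v hv] at huv
      exact hf₂ hu hv huv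
  · intro v hv
    rcases Finset.mem_union.mp hv with hv | hv
    · rw [hfS v hv]; exact hA' (hf₁A v hv)
    · rw [hfS' v hv]; exact (hf₂B' v hv).1
  · rw [edgesIn_union]
    refine EvenColored.disjoint_union (EvenColored.disjoint_union ?_ ?_ (disjoint_edgesIn H hd)) ?_
      (disjoint_edgesIn_edgesBetween H hd)
    · refine hf₁e.congr fun e he => ?_
      induction e with | _ u v
      rw [mk_mem_edgesIn] at he
      rw [Sym2.map_mk, Sym2.map_mk, hfS u he.1, hfS v he.2.1]
    · refine hf₂e.congr fun e he => ?_
      induction e with | _ u v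
      rw [mk_mem_edgesIn] at he
      rw [Sym2.map_mk, Sym2.map_mk, hfS' u he.1, hfS' v he.2.1]
    · refine evenColored_of_const (g := g) (by rwa [card_image_edgesBetween H hd]) fun e he => ?_
      obtain ⟨⟨u, v⟩, hx, rfl⟩ := Finset.mem_image.mp he
      rw [mem_edgesBetween] at hx
      rw [Sym2.map_mk, hfS u hx.1, hfS' v hx.2.1]
      exact ((hf₂B' v hx.2.1).2 ⟨u, hx.1⟩).2

end EdgesIn

/-! ### Splitting off vertices, non-adjacent pairs and copies of `K₄` -/

section Unavoidable

set_option linter.unusedSectionVars false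
set_option linter.unusedSimpArgs false

variable {V : Type*} [DecidableEq V]

theorem evenColored_pair {α L : Type*} {χ : Sym2 α → L} {f : V → α} {e e' : Sym2 V} (h : e ≠ e')
    (hχ : χ (e.map f) = χ (e'.map f)) : EvenColored χ f {e, e'} := by
  refine evenColored_of_const (g := χ (e'.map f)) (by rw [Finset.card_pair h]; exact even_two) ?_
  intro x hx
  rw [Finset.mem_insert, Finset.mem_singleton] at hx
  rcases hx with rfl | rfl
  · exact hχ
  · rfl

/-- The size needed for a twisted `K₄` with `k + 1` colours, the additional one being that of the
diagonal. The constant 1050 is `525 + 525`, with equality of the exponents of two for `k = 1`. -/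
theorem poly_mul_two_pow_le_of_log {k N : ℕ} (hk : 1 ≤ k) (hN : 0 < N)
    (h : 1050 * (k : ℝ) ≤ Real.log N) :
    32 * ((k + 1 : ℕ) : ℝ) ^ 5 * (2 ^ 520) ^ (k + 1) ≤ N := by
  have hN0 : (0 : ℝ) < N := by exact_mod_cast hN
  have h1 : (2 : ℝ) ^ (1050 * k) ≤ N := by
    rw [Real.le_log_iff_exp_le hN0] at h
    refine le_trans ?_ h
    have h2 : (2 : ℝ) ≤ Real.exp 1 := by linarith [Real.exp_one_gt_d9]
    calc (2 : ℝ) ^ (1050 * k) ≤ Real.exp 1 ^ (1050 * k) := by gcongr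
      _ = Real.exp (1050 * k) := by rw [← Real.exp_nat_mul]; push_cast; simp
  refine le_trans ?_ h1
  have h2 : ((k + 1 : ℕ) : ℝ) ≤ 2 ^ k := by
    exact_mod_cast (Nat.lt_two_pow_self : k < 2 ^ k)
  calc 32 * ((k + 1 : ℕ) : ℝ) ^ 5 * (2 ^ 520) ^ (k + 1)
      ≤ 2 ^ 5 * (2 ^ k) ^ 5 * (2 ^ 520) ^ (k + 1) := by gcongr; norm_num
    _ = 2 ^ (5 + k * 5 + 520 * (k + 1)) := by rw [← pow_mul, ← pow_mul, ← pow_add, ← pow_add]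
    _ ≤ 2 ^ (1050 * k) := pow_le_pow_right₀ (by norm_num) (by omega)

theorem edgesIn_four {H : SimpleGraph V} {a b c d : V} (hab : H.Adj a b) (hac : H.Adj a c)
    (had : H.Adj a d) (hbc : H.Adj b c) (hbd : H.Adj b d) (hcd : H.Adj c d) :
    edgesIn H {a, b, c, d} =
      ({s(a, b), s(c, d)} ∪ {s(a, c), s(a, d)}) ∪ {s(b, c), s(b, d)} := by
  apply Finset.Subset.antisymm
  · intro e
    induction e with | _ u v
    rw [mk_mem_edgesIn]
    simp only [Finset.mem_insert, Finset.mem_singleton]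
    rintro ⟨hu, hv, h⟩
    rcases hu with hu | hu | hu | hu <;> rcases hv with hv | hv | hv | hv <;> rw [hu, hv] at h ⊢ <;>
      first
      | exact absurd rfl h.ne
      | simp [Sym2.eq_iff]
  · intro e he
    simp only [Finset.mem_union, Finset.mem_insert, Finset.mem_singleton] at he
    rcases he with ((rfl | rfl) | (rfl | rfl)) | (rfl | rfl) <;>
      refine mk_mem_edgesIn.mpr ⟨by simp, by simp, by assumption⟩

theorem unavoidable_four {H : SimpleGraph V} {a b c d : V} (hab : H.Adj a b) (hac : H.Adj a c)
    (had : H.Adj a d) (hbc : H.Adj b c) (hbd : H.Adj b d) (hcd : H.Adj c d) :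
    Unavoidable 1050 H {a, b, c, d} := by
  classical
  intro β hβ
  refine ⟨1, fun α L _ χ A hA hk => ?_⟩
  obtain ⟨a0, ha0⟩ : A.Nonempty := Finset.card_pos.mp (by omega)
  have hL : Nonempty L := ⟨χ s(a0, a0)⟩
  have : Nonempty A := ⟨⟨a0, ha0⟩⟩
  have hL1 : 1 ≤ Fintype.card L := Fintype.card_pos
  obtain ⟨u, v, x, y, huv, hxy, hux, huy, hvx, hvy, e1, e2, e3⟩ :=
    exists_twisted_four (α := A) (L := Option L)
    -- The diagonal gets a colour of its own, as `χ` is arbitrary there.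
    (c := fun x y => if x = y then none else some (χ s(x.1, y.1)))
    (by intro x y; simp only [eq_comm (a := x), Sym2.eq_swap (a := x.1)])
    (by intro x y; by_cases h : x = y <;> simp [h])
    (by
      rw [Fintype.card_option, Fintype.card_coe]
      refine poly_mul_two_pow_le_of_log hL1 hA (le_trans ?_ hk)
      gcongr)
  simp only [huv, hxy, hux, huy, hvx, hvy, if_false, Option.some.injEq] at e1 e2 e3
  set f : V → α := fun w => if w = a then u else if w = b then v else if w = c then x else y
    with hf
  have fa : f a = u := by simp [hf]
  have fb : f b = v := by simp [hf, hab.ne']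
  have fc : f c = x := by simp [hf, hac.ne', hbc.ne']
  have fd : f d = y := by simp [hf, had.ne', hbd.ne', hcd.ne']
  have hsub : ∀ {p q : A}, p ≠ q → (p : α) ≠ q := fun h h' => h (Subtype.ext h')
  refine ⟨f, ?_, ?_, ?_⟩
  · intro w hw w' hw' h
    simp only [Finset.coe_insert, Finset.coe_singleton, Set.mem_insert_iff,
      Set.mem_singleton_iff] at hw hw'
    rcases hw with rfl | rfl | rfl | rfl <;> rcases hw' with rfl | rfl | rfl | rfl <;>
      first
      | rfl
      | (simp only [fa, fb, fc, fd] at h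
         have h := Subtype.ext h
         first
         | exact (huv h).elim
         | exact (huv h.symm).elim
         | exact (hux h).elim
         | exact (hux h.symm).elim
         | exact (huy h).elim
         | exact (huy h.symm).elim
         | exact (hvx h).elim
         | exact (hvx h.symm).elim
         | exact (hvy h).elim
         | exact (hvy h.symm).elim
         | exact (hxy h).elim
         | exact (hxy h.symm).elim)
  · intro w hw
    simp only [Finset.mem_insert, Finset.mem_singleton] at hw
    rcases hw with rfl | rfl | rfl | rfl
    · rw [fa]; exact u.2
    · rw [fb]; exact v.2
    · rw [fc]; exact x.2
    · rw [fd]; exact y.2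
  · have n1 := hab.ne
    have n2 := hac.ne
    have n3 := had.ne
    have n4 := hbc.ne
    have n5 := hbd.ne
    have n6 := hcd.ne
    rw [edgesIn_four hab hac had hbc hbd hcd]
    refine EvenColored.disjoint_union (EvenColored.disjoint_union ?_ ?_ ?_) ?_ ?_
    · refine evenColored_pair (by simp [n1, n2, n3, n4, n5, n6]) ?_
      rw [Sym2.map_mk, Sym2.map_mk, fa, fb, fc, fd]; exact e3
    · refine evenColored_pair (by simp [n1, n2, n3, n4, n5, n6]) ?_
      rw [Sym2.map_mk, Sym2.map_mk, fa, fc, fd]; exact e1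
    · simp [n1, n2, n3, n4, n5, n6, n1.symm, n2.symm, n3.symm, n4.symm, n5.symm,
        n6.symm]
    · refine evenColored_pair (by simp [n1, n2, n3, n4, n5, n6]) ?_
      rw [Sym2.map_mk, Sym2.map_mk, fb, fc, fd]; exact e2
    · simp [n1, n2, n3, n4, n5, n6, n1.symm, n2.symm, n3.symm, n4.symm, n5.symm,
        n6.symm]

theorem card_edgesIn_four {H : SimpleGraph V} {a b c d : V} (hab : H.Adj a b) (hac : H.Adj a c)
    (had : H.Adj a d) (hbc : H.Adj b c) (hbd : H.Adj b d) (hcd : H.Adj c d) :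
    Even (edgesIn H {a, b, c, d}).card := by
  have n1 := hab.ne
  have n2 := hac.ne
  have n3 := had.ne
  have n4 := hbc.ne
  have n5 := hbd.ne
  have n6 := hcd.ne
  rw [edgesIn_four hab hac had hbc hbd hcd, Finset.card_union_of_disjoint,
    Finset.card_union_of_disjoint, Finset.card_pair, Finset.card_pair, Finset.card_pair]
  · decide
  all_goals simp [n1, n2, n3, n4, n5, n6, n1.symm, n2.symm, n3.symm, n4.symm,
    n5.symm, n6.symm]

theorem edgesIn_singleton (H : SimpleGraph V) (v : V) : edgesIn H {v} = ∅ := by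
  refine Finset.eq_empty_of_forall_notMem fun e => ?_
  induction e with | _ x y
  rw [mk_mem_edgesIn, Finset.mem_singleton, Finset.mem_singleton]
  rintro ⟨rfl, rfl, h⟩
  exact h.ne rfl

theorem edgesIn_pair_of_not_adj {H : SimpleGraph V} {u v : V} (h : ¬ H.Adj u v) :
    edgesIn H {u, v} = ∅ := by
  refine Finset.eq_empty_of_forall_notMem fun e => ?_
  induction e with | _ x y
  simp only [mk_mem_edgesIn, Finset.mem_insert, Finset.mem_singleton]
  rintro ⟨rfl | rfl, rfl | rfl, h'⟩
  · exact h'.ne rfl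
  · exact h h'
  · exact h h'.symm
  · exact h'.ne rfl

theorem edgesIn_pair_of_adj {H : SimpleGraph V} {u v : V} (h : H.Adj u v) :
    edgesIn H {u, v} = {s(u, v)} := by
  ext e
  induction e with | _ x y
  simp only [mk_mem_edgesIn, Finset.mem_insert, Finset.mem_singleton, Sym2.eq_iff]
  constructor
  · rintro ⟨rfl | rfl, rfl | rfl, h'⟩ <;> first | exact (h'.ne rfl).elim | tauto
  · rintro (⟨rfl, rfl⟩ | ⟨rfl, rfl⟩) <;> simp [h, h.symm]

theorem degreeIn_of_adj {H : SimpleGraph V} {S : Finset V} {v : V} (h : ∀ u ∈ S, H.Adj v u) :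
    degreeIn H S v = S.card := by
  classical
  unfold degreeIn
  rw [Finset.filter_true_of_mem h]

/-- Removing a set whose induced subgraph is unavoidable and that sends an even number of edges to
the remaining vertices. -/
theorem unavoidable_of_sdiff {H : SimpleGraph V} {S T : Finset V} (hTS : T ⊆ S)
    (hT : T.Nonempty) (hU : Unavoidable 1050 H T) (hTe : Even (edgesIn H T).card)
    (hb : Even (edgesBetween H T (S \ T)).card) (hS : Even (edgesIn H S).card)
    (ih : ∀ S' ⊂ S, Even (edgesIn H S').card → Unavoidable 1050 H S') :
    Unavoidable 1050 H S := by
  have hd : Disjoint T (S \ T) := Finset.disjoint_sdiff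
  have hu : T ∪ (S \ T) = S := Finset.union_sdiff_of_subset hTS
  have hcard := card_edgesIn_union H hd
  rw [hu] at hcard
  have hU' : Unavoidable 1050 H (S \ T) := by
    refine ih _ (Finset.sdiff_ssubset hTS hT) ?_
    rw [hcard] at hS
    exact (Nat.even_add.mp ((Nat.even_add.mp hS).mpr hb)).mp hTe
  have := hU.union (by norm_num) hU' hd hT hb
  rwa [hu] at this

/-- Every graph with an even number of edges is unavoidable. -/
theorem unavoidable_of_even (H : SimpleGraph V) (S : Finset V) (hS : Even (edgesIn H S).card) :
    Unavoidable 1050 H S := by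
  classical
  induction S using Finset.strongInduction with
  | H S ih =>
  rcases S.eq_empty_or_nonempty with rfl | hne
  · exact unavoidable_of_edgesIn_eq_empty (by simp [edgesIn])
  by_cases h1 : ∃ v ∈ S, Even (degreeIn H S v)
  · obtain ⟨v, hv, hev⟩ := h1
    refine unavoidable_of_sdiff (T := {v}) (by simpa using hv) (by simp)
      (unavoidable_of_edgesIn_eq_empty (edgesIn_singleton H v)) (by simp [edgesIn_singleton]) ?_
      hS ih
    rw [card_edgesBetween, Finset.sum_singleton, degreeIn_sdiff H (by simp)]
    exact hev
  push Not at h1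
  by_cases h2 : ∃ u ∈ S, ∃ v ∈ S, u ≠ v ∧ ¬ H.Adj u v
  · obtain ⟨u, hu, v, hv, huv, hadj⟩ := h2
    have he := edgesIn_pair_of_not_adj hadj
    refine unavoidable_of_sdiff (T := {u, v}) (by intro w; simp; rintro (rfl | rfl) <;> assumption)
      (by simp) (unavoidable_of_edgesIn_eq_empty he) (by simp [he]) ?_ hS ih
    rw [card_edgesBetween, Finset.sum_pair huv, degreeIn_sdiff H (by simp [hadj]),
      degreeIn_sdiff H (by simp [H.adj_comm v u, hadj])]
    exact (Nat.not_even_iff_odd.mp (h1 u hu)).add_odd (Nat.not_even_iff_odd.mp (h1 v hv))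
  push Not at h2
  -- The graph on `S` is now complete, and its degrees `|S| - 1` are odd.
  have hSe : Even S.card := by
    obtain ⟨v, hv⟩ := hne
    have h3 : degreeIn H S v = S.card - 1 := by
      rw [← degreeIn_sdiff H (T := {v}) (by simp), degreeIn_of_adj, Finset.sdiff_singleton_eq_erase,
        Finset.card_erase_of_mem hv]
      intro u hu
      simp only [Finset.mem_sdiff, Finset.mem_singleton] at hu
      exact h2 v hv u hu.1 (Ne.symm hu.2)
    have h4 := h1 v hv
    rw [h3] at h4
    have h5 : 0 < S.card := Finset.card_pos.mpr ⟨v, hv⟩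
    obtain ⟨m, hm⟩ := Nat.not_even_iff_odd.mp h4
    exact ⟨m + 1, by omega⟩
  -- The only smaller case is a single edge, which has an odd number of edges.
  by_cases h4 : S.card < 4
  · have hS2 : S.card = 2 := by
      have := Finset.card_pos.mpr hne
      obtain ⟨m, hm⟩ := hSe
      omega
    obtain ⟨u, v, huv, rfl⟩ := Finset.card_eq_two.mp hS2
    rw [edgesIn_pair_of_adj (h2 u (by simp) v (by simp) huv), Finset.card_singleton] at hS
    exact absurd hS (by decide)
  obtain ⟨T, hTS, hT4⟩ := Finset.exists_subset_card_eq (not_lt.mp h4)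
  have hb : Even (edgesBetween H T (S \ T)).card := by
    rw [card_edgesBetween, Finset.sum_congr rfl (g := fun _ => (S \ T).card), Finset.sum_const, hT4,
      smul_eq_mul]
    · exact Even.mul_right (by decide) _
    · intro v hv
      refine degreeIn_of_adj fun u hu => ?_
      rw [Finset.mem_sdiff] at hu
      exact h2 v (hTS hv) u hu.1 (by rintro rfl; exact hu.2 hv)
  obtain ⟨a, b, c, d, hab, hac, had, hbc, hbd, hcd, rfl⟩ := Finset.card_eq_four.mp hT4
  have adj : ∀ x ∈ ({a, b, c, d} : Finset V), ∀ y ∈ ({a, b, c, d} : Finset V), x ≠ y →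
      H.Adj x y := fun x hx y hy h => h2 x (hTS hx) y (hTS hy) h
  exact unavoidable_of_sdiff hTS (by simp)
    (unavoidable_four (adj a (by simp) b (by simp) hab) (adj a (by simp) c (by simp) hac)
      (adj a (by simp) d (by simp) had) (adj b (by simp) c (by simp) hbc)
      (adj b (by simp) d (by simp) hbd) (adj c (by simp) d (by simp) hcd))
    (card_edgesIn_four (adj a (by simp) b (by simp) hab) (adj a (by simp) c (by simp) hac)
      (adj a (by simp) d (by simp) had) (adj b (by simp) c (by simp) hbc)
      (adj b (by simp) d (by simp) hbd) (adj c (by simp) d (by simp) hcd)) hb hS ih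

end Unavoidable

/-! ### From unavoidability to `r_H(n)` and to subspaces -/

section Copies

variable {V : Type*}

theorem eventually_card_colors_ge [Finite V] (H : SimpleGraph V) (hH : Even H.edgeSet.ncard) :
    ∀ᶠ n : ℕ in atTop, ∀ (r : ℕ) (χ : (⊤ : SimpleGraph (Fin n)).edgeSet → Fin r),
      ¬ AdmitsEvenChromaticCopy χ H → 1 / 2102 * Real.log n ≤ r := by
  classical
  have : Fintype V := Fintype.ofFinite V
  have huniv : (edgesIn H Finset.univ : Set (Sym2 V)) = H.edgeSet := by
    ext e
    simp [edgesIn]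
  have hev : Even (edgesIn H Finset.univ).card := by
    rwa [← Set.ncard_coe_finset, huniv]
  obtain ⟨n₀, hn₀⟩ := unavoidable_of_even H Finset.univ hev 1051 (by norm_num)
  -- The colour `none` for the diagonal makes `r + 1` colours. If `r < log n / 2102`, both `1051 *
  -- r` and `1051` are at most half of `log n`.
  have hlog := (Real.tendsto_log_atTop.comp tendsto_natCast_atTop_atTop).eventually
    (eventually_ge_atTop (2102 : ℝ))
  filter_upwards [eventually_ge_atTop n₀, hlog] with n hn hlogn r χ hχ
  by_contra hr
  push Not at hr
  refine hχ ?_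
  simp only [Function.comp_apply] at hlogn
  set χ' : Sym2 (Fin n) → Option (Fin r) := fun e =>
    if h : e ∈ (⊤ : SimpleGraph (Fin n)).edgeSet then some (χ ⟨e, h⟩) else none with hχ'
  obtain ⟨f, hf, -, hfe⟩ := hn₀ (Fin n) (Option (Fin r)) χ' Finset.univ (by simpa using hn) (by
    rw [Fintype.card_option, Fintype.card_fin, Finset.card_univ, Fintype.card_fin]
    push_cast
    linarith)
  have hinj : Function.Injective f := by
    rw [Finset.coe_univ] at hf
    exact Set.injOn_univ.mp hf
  refine ⟨⟨f, hinj⟩, fun k => ?_⟩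
  have hk := hfe (some k)
  rw [← Finset.card_image_of_injective _ (Sym2.map.injective hinj), ← Set.ncard_coe_finset] at hk
  rw [← Set.ncard_image_of_injective _ Subtype.val_injective]
  convert hk using 2
  ext e
  simp only [Set.mem_image, Set.mem_ofPred_eq, Subtype.exists, exists_and_right, exists_eq_right,
    Finset.coe_image, Finset.coe_filter, Function.Embedding.coeFn_mk]
  have hmap : e ∈ (H.map f).edgeSet ↔ ∃ e' ∈ H.edgeSet, Sym2.map f e' = e := by
    have h := congrArg (e ∈ ·) (SimpleGraph.edgeSet_map (⟨f, hinj⟩ : V ↪ Fin n) H)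
    exact iff_of_eq h
  rw [hmap]
  constructor
  · rintro ⟨he, ⟨e', he', rfl⟩, hc⟩
    refine ⟨e', ⟨?_, ?_⟩, rfl⟩
    · rwa [← Finset.mem_coe, huniv]
    · rw [hχ']
      simp only
      rw [dif_pos he]
      exact congrArg some hc
  · rintro ⟨e', ⟨he', hc⟩, rfl⟩
    rw [← Finset.mem_coe, huniv] at he'
    have hmem : Sym2.map f e' ∈ (⊤ : SimpleGraph (Fin n)).edgeSet := by
      by_contra hcon
      rw [hχ'] at hc
      simp only at hc
      rw [dif_neg hcon] at hc
      cases hc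
    refine ⟨hmem, ⟨e', he', rfl⟩, ?_⟩
    rw [hχ'] at hc
    simp only at hc
    rw [dif_pos hmem] at hc
    exact Option.some.inj hc

theorem le_colorNumber {H : SimpleGraph V} {n : ℕ} {x : ℝ}
    (h : ∀ (r : ℕ) (χ : (⊤ : SimpleGraph (Fin n)).edgeSet → Fin r),
      ¬ AdmitsEvenChromaticCopy χ H → x ≤ r) :
    ENNReal.ofReal x ≤ (colorNumber H n : ℝ≥0∞) := by
  have h1 : ((⌈x⌉₊ : ℕ) : ℕ∞) ≤ colorNumber H n := by
    refine le_sInf ?_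
    rintro N ⟨r, rfl, χ, hχ⟩
    exact_mod_cast Nat.ceil_le.mpr (h r χ hχ)
  calc ENNReal.ofReal x ≤ ENNReal.ofReal (⌈x⌉₊ : ℝ) := ENNReal.ofReal_le_ofReal (Nat.le_ceil x)
    _ = (((⌈x⌉₊ : ℕ) : ℕ∞) : ℝ≥0∞) := by simp
    _ ≤ _ := by exact_mod_cast h1

/-- The indicator function of the edge set of a graph. -/
noncomputable def EdgeSpace.ofGraph {n : ℕ} (G : SimpleGraph (Fin n)) : EdgeSpace n :=
  open Classical in fun e => if e.1 ∈ G.edgeSet then 1 else 0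

theorem EdgeSpace.graph_ofGraph {n : ℕ} (G : SimpleGraph (Fin n)) :
    (EdgeSpace.ofGraph G).graph = G := by
  ext u v
  simp only [EdgeSpace.graph, EdgeSpace.ofGraph, SimpleGraph.fromEdgeSet_adj, Set.mem_ofPred_eq,
    SimpleGraph.mem_edgeSet]
  constructor
  · rintro ⟨⟨h, h'⟩, -⟩
    by_contra hG
    simp [hG] at h'
  · intro h
    exact ⟨⟨h.ne, by simp [h]⟩, h.ne⟩

theorem isCopyOf_map {n : ℕ} (H : SimpleGraph V) (f : V ↪ Fin n) : IsCopyOf (H.map f) H := by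
  refine ⟨Set.range f, ⟨?_⟩, ?_⟩
  · refine RelIso.symm ⟨Equiv.ofInjective f f.injective, ?_⟩
    intro u v
    simp
  · intro v hv w hw
    rw [SimpleGraph.map_adj] at hw
    obtain ⟨a, b, -, rfl, -⟩ := hw
    exact hv ⟨a, rfl⟩

/-- Modulo `C`, the indicator of a copy is the sum of the colours of its edges. If each colour
occurs evenly often, this sum is zero over `𝔽₂`, and the copy lies in `C`. -/
theorem not_admits_of_submodule {n : ℕ} {H : SimpleGraph V} (C : Submodule (ZMod 2) (EdgeSpace n))
    (hC : ∀ x ∈ C, ¬ IsCopyOf x.graph H) {K : Type*} (i : (EdgeSpace n ⧸ C) ↪ K) :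
    ¬ AdmitsEvenChromaticCopy (fun e => i (C.mkQ (Pi.single e 1))) H := by
  classical
  rintro ⟨f, hf⟩
  refine hC (EdgeSpace.ofGraph (H.map f)) ?_ (by
    rw [EdgeSpace.graph_ofGraph]; exact isCopyOf_map H f)
  rw [← Submodule.ker_mkQ C, LinearMap.mem_ker]
  set F := (Finset.univ : Finset (⊤ : SimpleGraph (Fin n)).edgeSet).filter
    fun e => e.1 ∈ (H.map f).edgeSet with hF
  have h1 : EdgeSpace.ofGraph (H.map f) = ∑ e ∈ F, Pi.single e (1 : ZMod 2) := by
    funext e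
    rw [Finset.sum_apply]
    simp only [EdgeSpace.ofGraph, Pi.single_apply, Finset.sum_ite_eq, hF, Finset.mem_filter,
      Finset.mem_univ, true_and]
    congr
  rw [h1, map_sum]
  have : Finite (EdgeSpace n ⧸ C) := inferInstance
  have : Fintype (EdgeSpace n ⧸ C) := Fintype.ofFinite _
  rw [← Finset.sum_fiberwise_of_maps_to (t := Finset.univ)
    (g := fun e => C.mkQ (Pi.single e 1)) (fun _ _ => Finset.mem_univ _)]
  refine Finset.sum_eq_zero fun y _ => ?_
  rw [Finset.sum_congr rfl (g := fun _ => y) (fun e he => (Finset.mem_filter.mp he).2),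
    Finset.sum_const]
  have h2 := hf (i y)
  have h3 : {e : (⊤ : SimpleGraph (Fin n)).edgeSet |
      e.1 ∈ (H.map f).edgeSet ∧ i (C.mkQ (Pi.single e 1)) = i y} =
      ((F.filter fun e => C.mkQ (Pi.single e 1) = y : Finset _) : Set _) := by
    ext e
    simp [hF, i.injective.eq_iff]
  rw [h3, Set.ncard_coe_finset] at h2
  rw [← Nat.cast_smul_eq_nsmul (ZMod 2), (ZMod.natCast_eq_zero_iff_even).mpr h2, zero_smul]

theorem linDensity_le {H : SimpleGraph V} {n : ℕ} {x : ℝ} (hx : 0 < x)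
    (h : ∀ (r : ℕ) (χ : (⊤ : SimpleGraph (Fin n)).edgeSet → Fin r),
      ¬ AdmitsEvenChromaticCopy χ H → x ≤ r) :
    linDensity H n ≤ x⁻¹ := by
  classical
  have hE : Nat.card (EdgeSpace n) = 2 ^ n.choose 2 := by
    rw [Nat.card_fun, Nat.card_zmod, Nat.card_eq_fintype_card, ← SimpleGraph.edgeFinset_card,
      SimpleGraph.card_edgeFinset_top_eq_card_choose_two, Fintype.card_fin]
  have hbound : ∀ N ∈ {N : ℕ | ∃ C : Submodule (ZMod 2) (EdgeSpace n),
      (∀ x ∈ C, ¬ IsCopyOf x.graph H) ∧ N = Nat.card C}, (N : ℝ) ≤ 2 ^ n.choose 2 * x⁻¹ := by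
    rintro N ⟨C, hC, rfl⟩
    -- The number of colours is the index of `C`, so the density of `C` is its inverse.
    have h1 := h _ _ (not_admits_of_submodule C hC (Finite.equivFin (EdgeSpace n ⧸ C)).toEmbedding)
    have h2 := Submodule.card_eq_card_quotient_mul_card C
    rw [hE] at h2
    have h3 : (2 : ℝ) ^ n.choose 2 = Nat.card C * Nat.card (EdgeSpace n ⧸ C) := by
      exact_mod_cast h2
    rw [h3, ← div_eq_mul_inv, le_div_iff₀ hx]
    gcongr
  unfold linDensity
  rw [div_le_iff₀ (by positivity), mul_comm]
  have h4 : sSup {N : ℕ | ∃ C : Submodule (ZMod 2) (EdgeSpace n),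
      (∀ x ∈ C, ¬ IsCopyOf x.graph H) ∧ N = Nat.card C} ≤ ⌊2 ^ n.choose 2 * x⁻¹⌋₊ :=
    csSup_le' fun N hN => Nat.le_floor (hbound N hN)
  exact (Nat.cast_le.mpr h4).trans (Nat.floor_le (by positivity))

end Copies

end GraphCode

theorem theorem2 :
    ∃ c : ℝ, 0 < c ∧
      ∀ (V : Type*) [Finite V] (H : SimpleGraph V), Even H.edgeSet.ncard →
        ∀ᶠ n : ℕ in atTop,
          ENNReal.ofReal (c * Real.log n) ≤ (GraphCode.colorNumber H n : ℝ≥0∞) ∧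
          GraphCode.linDensity H n ≤ (c * Real.log n)⁻¹ := by
  refine ⟨1 / 2102, by norm_num, fun V _ H hH => ?_⟩
  filter_upwards [GraphCode.eventually_card_colors_ge H hH, eventually_ge_atTop 2] with n hn hn2
  have hlog : 0 < Real.log n := Real.log_pos (by exact_mod_cast hn2)
  exact ⟨GraphCode.le_colorNumber hn, GraphCode.linDensity_le (by positivity) hn⟩
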